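/- Let $\mathbb H$ be the discrete Heisenberg group, i.e. the group generated by two elements $a,b$ subject to the relations asserting that the commutator $[a,b]=aba^{-1}b^{-1}$ is central, and let $d_W$ be the left-invariant word metric on $\mathbb H$ induced by the symmetric generating set $\{a,b,a^{-1},b^{-1}\}$. A metric space $X$ is called $K$-doubling if every closed ball in $X$ can be covered by at most $K$ closed balls of half its radius (with centers in $X$). Write $L_p=L_p([0,1])$ for the space of real-valued $p$-integrable functions with respect to Lebesgue measure. Then there is a universal constant $C\in(0,\infty)$ such that for every $\varepsilon\in(0,1/2]$ and every $p\in[2,\infty)$ there exists a mapping $F_{\varepsilon,p}:\mathbb H\to L_p$ such that $F_{\varepsilon,p}(\mathbb H)\subseteq L_p$, with the metric inherited from $L_p$, is $2^{16}$-doubling and $$ \forall\, x,y\in\mathbb H,\qquad d_W(x,y)^{1-\varepsilon}\le \|F_{\varepsilon,p}(x)-F_{\varepsilon,p}(y)\|_p\le C\,\frac{d_W(x,y)^{1-\varepsilon}}{\varepsilon^{1/p}}. $$ -/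

import Mathlib

open MeasureTheory
open scoped ENNReal commutatorElement

/-- The relators of the discrete Heisenberg group on the free generators `a = of 0`, `b = of 1`:
they say that the commutator `⁅a, b⁆ = a * b * a⁻¹ * b⁻¹` commutes with every element. -/
def heisenbergRels : Set (FreeGroup (Fin 2)) :=
  Set.range fun g : FreeGroup (Fin 2) =>
    ⁅⁅(FreeGroup.of 0 : FreeGroup (Fin 2)), (FreeGroup.of 1 : FreeGroup (Fin 2))⁆, g⁆

/-- The discrete Heisenberg group: the group generated by two elements `a`, `b`, subject to the
relations asserting that the commutator `⁅a, b⁆` is central. -/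
abbrev DiscreteHeisenberg : Type := PresentedGroup heisenbergRels

namespace DiscreteHeisenberg

/-- The first generator. -/
def a : DiscreteHeisenberg := PresentedGroup.of 0

/-- The second generator. -/
def b : DiscreteHeisenberg := PresentedGroup.of 1

/-- The symmetric generating set `{a, b, a⁻¹, b⁻¹}`. -/
def gens : Set DiscreteHeisenberg := {a, b, a⁻¹, b⁻¹}

/-- The word length with respect to `gens`: the least length of a word in the letters
`a, b, a⁻¹, b⁻¹` that represents `x`. -/
noncomputable def wordLength (x : DiscreteHeisenberg) : ℕ :=
  sInf {n : ℕ | ∃ l : List DiscreteHeisenberg, (∀ g ∈ l, g ∈ gens) ∧ l.prod = x ∧ l.length = n}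

/-- The left-invariant word metric on the discrete Heisenberg group. -/
noncomputable def wordDist (x y : DiscreteHeisenberg) : ℕ := wordLength (x⁻¹ * y)

/-- Every element is represented by some word, so the infimum in `wordLength` is a minimum. -/
theorem exists_word_length_eq (x : DiscreteHeisenberg) :
    ∃ l : List DiscreteHeisenberg, (∀ g ∈ l, g ∈ gens) ∧ l.prod = x ∧ l.length = wordLength x := by
  have hne : {n : ℕ | ∃ l : List DiscreteHeisenberg,
      (∀ g ∈ l, g ∈ gens) ∧ l.prod = x ∧ l.length = n}.Nonempty := by
    have hx : x ∈ Subgroup.closure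
        (Set.range (PresentedGroup.of : Fin 2 → DiscreteHeisenberg)) := by
      rw [PresentedGroup.closure_range_of]
      trivial
    rw [← Subgroup.mem_toSubmonoid, Subgroup.closure_toSubmonoid] at hx
    obtain ⟨l, hl, hp⟩ := Submonoid.exists_list_of_mem_closure hx
    refine ⟨l.length, l, fun g hg => ?_, hp, rfl⟩
    rcases hl g hg with ⟨i, hi⟩ | ⟨i, hi⟩
    · fin_cases i
      · exact Or.inl hi.symm
      · exact Or.inr (Or.inl hi.symm)
    · have hg' : g = (PresentedGroup.of i : DiscreteHeisenberg)⁻¹ := by rw [hi, inv_inv]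
      fin_cases i
      · exact Or.inr (Or.inr (Or.inl hg'))
      · exact Or.inr (Or.inr (Or.inr hg'))
  exact Nat.sInf_mem hne

end DiscreteHeisenberg

/-- A metric space is `K`-doubling if every (closed) ball in it can be covered by at most `K`
(closed) balls, centred in the space, of half its radius. -/
def IsKDoubling (K : ℝ) (X : Type*) [PseudoMetricSpace X] : Prop :=
  ∀ (x : X) (r : ℝ), 0 < r →
    ∃ s : Finset X, (s.card : ℝ) ≤ K ∧
      Metric.closedBall x r ⊆ ⋃ y ∈ s, Metric.closedBall y (r / 2)

/-- The space `L_p = L_p([0,1])` of real-valued functions, for Lebesgue measure. -/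
noncomputable abbrev LpUnit (p : ℝ) := Lp ℝ (ENNReal.ofReal p) (volume.restrict (Set.Icc (0 : ℝ) 1))

/-! The coordinates of ℍ in the Heisenberg group on ℝ³ make word length comparable to the gauge
max(|x₁|, |x₂|, √|x₃|) (`heisGauge_coords_le`, `wordLength_le_heisGauge`). It therefore suffices to
map the real group into `L_p` with left-invariant, homogeneous distances comparable to the gauge to
the power 1 - ε.

Put s = (1 - ε)p and q = s / (1 - ε/2), so that s < q < p. Send x to its `profile`: the right
translates of a bump function by x rescaled by 1/t, at all scales t, with weight t^(s-1) dt. The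
q-th power of the `L_q` distance of two profiles is the `energy` of x⁻¹y. It is homogeneous of
degree s and comparable to the gauge to the power s; the large scales cost a factor 1/(q - s) ≤ 2/ε
(`le_energy`, `energy_le`). Composing the profile values with an isometric embedding of (ℝ, |a -
b|^(q/p)) into `L_p(ℝ)` (`exists_snowflake`) gives a map into an `L_p` space with distance
`energy`^(1/p), of degree s/p = 1 - ε. The p-th root turns 1/ε into ε^(-1/p).

For doubling, `energy`^(1/q) is subadditive by Minkowski and homogeneous of degree 1 - ε/2 ≥ 3/4. As
volume scales with exponent 4, `card_le_of_separated` bounds separated sets with exponent at most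
16/3. A ratio 2 of radii in the image is a ratio 2^(p/q) ≤ 2^(3/2) for `energy`^(1/q), and (1 +
2·2^(3/2))^(16/3) ≤ 8^(16/3) = 2^16. With q = p the same count would give 5^8 > 2^16 at ε = 1/2;
hence the detour through q < p and a snowflake. -/

/-! ### The real Heisenberg group in coordinates and its gauge. -/

/-- The underlying space `ℝ³` of the real Heisenberg group. -/
def RealHeisenberg : Type := ℝ × ℝ × ℝ

/-- The Heisenberg group law on `ℝ³`. -/
def heisMul (x y : ℝ × ℝ × ℝ) : ℝ × ℝ × ℝ :=
  (x.1 + y.1, x.2.1 + y.2.1, x.2.2 + y.2.2 + x.1 * y.2.1)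

/-- The inverse for the Heisenberg group law on `ℝ³`. -/
def heisInv (x : ℝ × ℝ × ℝ) : ℝ × ℝ × ℝ :=
  (-x.1, -x.2.1, -x.2.2 + x.1 * x.2.1)

theorem heisMul_assoc (x y z : ℝ × ℝ × ℝ) :
    heisMul (heisMul x y) z = heisMul x (heisMul y z) := by
  simp only [heisMul, Prod.mk.injEq]
  refine ⟨by ring, by ring, by ring⟩

theorem zero_heisMul (x : ℝ × ℝ × ℝ) : heisMul 0 x = x := by
  simp [heisMul]

theorem heisMul_zero (x : ℝ × ℝ × ℝ) : heisMul x 0 = x := by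
  simp [heisMul]

theorem heisInv_heisMul (x : ℝ × ℝ × ℝ) : heisMul (heisInv x) x = 0 := by
  simp only [heisMul, heisInv, Prod.ext_iff, Prod.fst_zero, Prod.snd_zero]
  refine ⟨by ring, by ring, by ring⟩

theorem heisMul_heisInv (x : ℝ × ℝ × ℝ) : heisMul x (heisInv x) = 0 := by
  simp only [heisMul, heisInv, Prod.ext_iff, Prod.fst_zero, Prod.snd_zero]
  refine ⟨by ring, by ring, by ring⟩

theorem heisInv_heisInv (x : ℝ × ℝ × ℝ) : heisInv (heisInv x) = x := by
  simp only [heisInv, Prod.ext_iff]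
  refine ⟨by ring, by ring, by ring⟩

theorem heisInv_heisMul_rev (x y : ℝ × ℝ × ℝ) :
    heisInv (heisMul x y) = heisMul (heisInv y) (heisInv x) := by
  simp only [heisMul, heisInv, Prod.ext_iff]
  refine ⟨by ring, by ring, by ring⟩

instance : Group RealHeisenberg where
  mul := heisMul
  one := (0 : ℝ × ℝ × ℝ)
  inv := heisInv
  mul_assoc := heisMul_assoc
  one_mul := zero_heisMul
  mul_one := heisMul_zero
  inv_mul_cancel := heisInv_heisMul

/-- The homogeneous gauge `max |x₁| |x₂| √|x₃|` of the Heisenberg group. -/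
noncomputable def heisGauge (x : ℝ × ℝ × ℝ) : ℝ := max |x.1| (max |x.2.1| √|x.2.2|)

theorem heisGauge_nonneg (x : ℝ × ℝ × ℝ) : 0 ≤ heisGauge x :=
  (abs_nonneg _).trans (le_max_left _ _)

theorem heisGauge_le_iff {x : ℝ × ℝ × ℝ} {r : ℝ} (hr : 0 ≤ r) :
    heisGauge x ≤ r ↔ |x.1| ≤ r ∧ |x.2.1| ≤ r ∧ |x.2.2| ≤ r ^ 2 := by
  rw [heisGauge, max_le_iff, max_le_iff, Real.sqrt_le_left hr]

theorem heisGauge_pos {x : ℝ × ℝ × ℝ} (hx : x ≠ 0) : 0 < heisGauge x := by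
  by_contra h
  have h0 := (heisGauge_le_iff le_rfl).1 (not_lt.1 h)
  apply hx
  have h1 : |x.1| ≤ 0 := h0.1
  have h2 : |x.2.1| ≤ 0 := h0.2.1
  have h3 : |x.2.2| ≤ 0 := by simpa using h0.2.2
  rw [abs_nonpos_iff] at h1 h2 h3
  ext <;> simp [h1, h2, h3]

/-! ### Word length is comparable to the gauge of the coordinates. -/

namespace DiscreteHeisenberg

/-- The image of a generator in the real Heisenberg group. -/
def realGenerator (i : Fin 2) : RealHeisenberg :=
  if i = 0 then ((1, 0, 0) : ℝ × ℝ × ℝ) else ((0, 1, 0) : ℝ × ℝ × ℝ)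

theorem lift_realGenerator_rels (r : FreeGroup (Fin 2)) (hr : r ∈ heisenbergRels) :
    FreeGroup.lift realGenerator r = 1 := by
  obtain ⟨g, rfl⟩ := hr
  simp only [map_commutatorElement, FreeGroup.lift_apply_of]
  rw [commutatorElement_eq_one_iff_mul_comm]
  generalize FreeGroup.lift realGenerator g = y
  have hc : heisMul (heisMul (heisMul (1, 0, 0) (0, 1, 0)) (heisInv (1, 0, 0)))
      (heisInv (0, 1, 0)) = (0, 0, 1) := by simp [heisMul, heisInv]
  change heisMul (heisMul (heisMul (heisMul (1, 0, 0) (0, 1, 0)) (heisInv (1, 0, 0)))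
      (heisInv (0, 1, 0))) y = heisMul y (heisMul (heisMul (heisMul (1, 0, 0) (0, 1, 0))
      (heisInv (1, 0, 0))) (heisInv (0, 1, 0)))
  rw [hc]
  simp [heisMul, add_comm]

/-- The embedding of the discrete Heisenberg group into the real one. -/
def toReal : DiscreteHeisenberg →* RealHeisenberg :=
  PresentedGroup.toGroup lift_realGenerator_rels

/-- The coordinates in `ℝ³` of an element of the discrete Heisenberg group. -/
def coords (x : DiscreteHeisenberg) : ℝ × ℝ × ℝ := toReal x

theorem coords_mul (x y : DiscreteHeisenberg) :
    coords (x * y) = heisMul (coords x) (coords y) :=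
  map_mul toReal x y

theorem coords_inv (x : DiscreteHeisenberg) : coords x⁻¹ = heisInv (coords x) :=
  map_inv toReal x

theorem coords_one : coords 1 = 0 := map_one toReal

theorem coords_a : coords a = (1, 0, 0) := by
  change toReal (PresentedGroup.of 0) = _
  rw [toReal, PresentedGroup.toGroup.of]
  rfl

theorem coords_b : coords b = (0, 1, 0) := by
  change toReal (PresentedGroup.of 1) = _
  rw [toReal, PresentedGroup.toGroup.of]
  rfl

/-- Prepending a letter changes the central coordinate by at most the absolute value of the second
coordinate, hence by at most the length n; and n² + n ≤ (n + 1)². -/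
theorem coords_prod_bound (l : List DiscreteHeisenberg) (hl : ∀ g ∈ l, g ∈ gens) :
    |(coords l.prod).1| ≤ l.length ∧ |(coords l.prod).2.1| ≤ l.length ∧
      |(coords l.prod).2.2| ≤ (l.length : ℝ) ^ 2 := by
  induction l with
  | nil => simp [coords_one]
  | cons g l ih =>
    obtain ⟨h1, h2, h3⟩ := ih fun x hx => hl x (List.mem_cons_of_mem _ hx)
    have hg : (|(coords g).1| ≤ 1 ∧ |(coords g).2.1| ≤ 1) ∧ (coords g).2.2 = 0 := by
      have : g ∈ gens := hl g List.mem_cons_self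
      rcases this with rfl | rfl | rfl | rfl <;>
        norm_num [coords_inv, coords_a, coords_b, heisInv]
    obtain ⟨⟨g1, g2⟩, g3⟩ := hg
    rw [List.prod_cons, coords_mul, List.length_cons]
    simp only [heisMul, g3, zero_add, Nat.cast_add, Nat.cast_one]
    refine ⟨(abs_add_le _ _).trans (by linarith), (abs_add_le _ _).trans (by linarith), ?_⟩
    have h4 : |(coords g).1 * (coords l.prod).2.1| ≤ l.length := by
      rw [abs_mul]
      calc _ ≤ 1 * (l.length : ℝ) := by gcongr
        _ = _ := one_mul _
    refine (abs_add_le _ _).trans ?_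
    nlinarith [(Nat.cast_nonneg l.length : (0 : ℝ) ≤ l.length)]

theorem heisGauge_coords_le (x : DiscreteHeisenberg) :
    heisGauge (coords x) ≤ wordLength x := by
  obtain ⟨l, hl, hp, hn⟩ := exists_word_length_eq x
  rw [heisGauge_le_iff (Nat.cast_nonneg _), ← hn, ← hp]
  exact coords_prod_bound l hl

theorem wordLength_le_of_prod {l : List DiscreteHeisenberg} (hl : ∀ g ∈ l, g ∈ gens) :
    wordLength l.prod ≤ l.length :=
  Nat.sInf_le ⟨l, hl, rfl, rfl⟩

theorem wordLength_mul_le (x y : DiscreteHeisenberg) :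
    wordLength (x * y) ≤ wordLength x + wordLength y := by
  obtain ⟨l, hl, hp, hn⟩ := exists_word_length_eq x
  obtain ⟨m, hm, hq, hk⟩ := exists_word_length_eq y
  have h := wordLength_le_of_prod (l := l ++ m) fun g hg =>
    (List.mem_append.1 hg).elim (hl g) (hm g)
  rwa [List.prod_append, hp, hq, List.length_append, hn, hk] at h

theorem wordLength_one : wordLength 1 = 0 := by
  simpa using wordLength_le_of_prod (l := []) (by simp)

theorem wordLength_gen {g : DiscreteHeisenberg} (hg : g ∈ gens) : wordLength g ≤ 1 := by
  simpa using wordLength_le_of_prod (l := [g]) (by simpa using hg)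

theorem inv_mem_gens {g : DiscreteHeisenberg} (hg : g ∈ gens) : g⁻¹ ∈ gens := by
  rcases hg with rfl | rfl | rfl | rfl <;> simp [gens]

theorem wordLength_inv_le (x : DiscreteHeisenberg) : wordLength x⁻¹ ≤ wordLength x := by
  obtain ⟨l, hl, hp, hn⟩ := exists_word_length_eq x
  have h := wordLength_le_of_prod (l := (l.map fun g => g⁻¹).reverse) (by
    intro g hg
    obtain ⟨g', hg', rfl⟩ := List.mem_map.1 (List.mem_reverse.1 hg)
    exact inv_mem_gens (hl g' hg'))
  rwa [← List.prod_inv_reverse, List.length_reverse, List.length_map, hp, hn] at h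

theorem wordLength_pow_le (x : DiscreteHeisenberg) (n : ℕ) :
    wordLength (x ^ n) ≤ n * wordLength x := by
  induction n with
  | zero => simp [wordLength_one]
  | succ n ih =>
    rw [pow_succ, add_mul, one_mul]
    exact (wordLength_mul_le _ _).trans (by gcongr)

theorem wordLength_gen_pow_le {g : DiscreteHeisenberg} (hg : g ∈ gens) (n : ℕ) :
    wordLength (g ^ n) ≤ n :=
  (wordLength_pow_le g n).trans (by simpa using Nat.mul_le_mul_left n (wordLength_gen hg))

theorem wordLength_gen_zpow_le {g : DiscreteHeisenberg} (hg : g ∈ gens) (n : ℤ) :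
    wordLength (g ^ n) ≤ n.natAbs := by
  rcases Int.natAbs_eq n with h | h
  · conv_lhs => rw [h]
    rw [zpow_natCast]
    exact wordLength_gen_pow_le hg n.natAbs
  · conv_lhs => rw [h]
    rw [zpow_neg, zpow_natCast]
    exact (wordLength_inv_le _).trans (wordLength_gen_pow_le hg _)

/-- The central element `[a, b]`. -/
def z : DiscreteHeisenberg := ⁅a, b⁆

theorem z_commute (x : DiscreteHeisenberg) : Commute z x := by
  obtain ⟨g, rfl⟩ := PresentedGroup.mk_surjective heisenbergRels x
  have h : (PresentedGroup.mk heisenbergRels)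
      ⁅⁅(FreeGroup.of 0 : FreeGroup (Fin 2)), (FreeGroup.of 1 : FreeGroup (Fin 2))⁆, g⁆ = 1 :=
    PresentedGroup.one_of_mem ⟨g, rfl⟩
  rw [map_commutatorElement, commutatorElement_eq_one_iff_commute, map_commutatorElement] at h
  exact h

theorem a_mul_b : a * b = z * (b * a) := by
  simp [z, commutatorElement_def, mul_assoc]

theorem a_pow_mul_b (m : ℕ) : a ^ m * b = z ^ m * (b * a ^ m) := by
  induction m with
  | zero => simp
  | succ m ih =>
    calc a ^ (m + 1) * b = a * (a ^ m * b) := by rw [pow_succ', mul_assoc]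
      _ = a * (z ^ m * (b * a ^ m)) := by rw [ih]
      _ = z ^ m * (a * b) * a ^ m := by
        rw [← mul_assoc, ← ((z_commute a).pow_left m).eq]; simp only [mul_assoc]
      _ = z ^ (m + 1) * (b * a ^ (m + 1)) := by
        rw [a_mul_b, pow_succ, pow_succ']; simp only [mul_assoc]

theorem a_pow_mul_b_pow (m n : ℕ) : a ^ m * b ^ n = z ^ (m * n) * (b ^ n * a ^ m) := by
  induction n with
  | zero => simp
  | succ n ih =>
    calc a ^ m * b ^ (n + 1) = a ^ m * b ^ n * b := by rw [pow_succ, mul_assoc]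
      _ = z ^ (m * n) * b ^ n * (a ^ m * b) := by rw [ih]; simp only [mul_assoc]
      _ = z ^ (m * n) * (b ^ n * z ^ m) * (b * a ^ m) := by
        rw [a_pow_mul_b]; simp only [mul_assoc]
      _ = z ^ (m * (n + 1)) * (b ^ (n + 1) * a ^ m) := by
        rw [← ((z_commute (b ^ n)).pow_left m).eq, mul_add, mul_one, pow_add, pow_succ]
        simp only [mul_assoc]

/-- The commutator of a^m and b^n is a word of length 2m + 2n equal to z^(mn). This quadratic
distortion of the centre explains the square root in the gauge. -/
theorem z_pow_mul (m n : ℕ) : z ^ (m * n) = a ^ m * b ^ n * ((a ^ m)⁻¹ * (b ^ n)⁻¹) := by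
  rw [a_pow_mul_b_pow, mul_assoc, mul_assoc]; simp

theorem a_mem_gens : a ∈ gens := by simp [gens]

theorem b_mem_gens : b ∈ gens := by simp [gens]

theorem wordLength_z_pow_mul_le (m n : ℕ) : wordLength (z ^ (m * n)) ≤ 2 * m + 2 * n := by
  rw [z_pow_mul]
  have h1 := wordLength_mul_le (a ^ m * b ^ n) ((a ^ m)⁻¹ * (b ^ n)⁻¹)
  have h2 := wordLength_mul_le (a ^ m) (b ^ n)
  have h3 := wordLength_mul_le (a ^ m)⁻¹ (b ^ n)⁻¹
  have h4 := wordLength_inv_le (a ^ m)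
  have h5 := wordLength_inv_le (b ^ n)
  have h6 := wordLength_gen_pow_le a_mem_gens m
  have h7 := wordLength_gen_pow_le b_mem_gens n
  omega

theorem wordLength_z_pow_le (k : ℕ) : wordLength (z ^ k) ≤ 10 * k.sqrt := by
  rcases Nat.eq_zero_or_pos k with rfl | hk
  · simp [wordLength_one]
  · have hm : 0 < k.sqrt := Nat.sqrt_pos.2 hk
    have h1 := Nat.sqrt_le k
    have h2 := Nat.sqrt_le_add k
    -- With m = √k rounded down, k = m² + r and r ≤ 2m, so the length is at most 4m + (2r + 2) ≤ 8m
    -- + 2 ≤ 10m, as m ≥ 1.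
    obtain ⟨r, hr⟩ := Nat.exists_eq_add_of_le h1
    have h3 := wordLength_mul_le (z ^ (k.sqrt * k.sqrt)) (z ^ (r * 1))
    have h4 := wordLength_z_pow_mul_le k.sqrt k.sqrt
    have h5 := wordLength_z_pow_mul_le r 1
    rw [← pow_add, mul_one, ← hr] at h3
    rw [mul_one] at h5
    omega

theorem wordLength_z_zpow_le (k : ℤ) : wordLength (z ^ k) ≤ 10 * k.natAbs.sqrt := by
  rcases Int.natAbs_eq k with h | h
  · conv_lhs => rw [h]
    rw [zpow_natCast]
    exact wordLength_z_pow_le k.natAbs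
  · conv_lhs => rw [h]
    rw [zpow_neg, zpow_natCast]
    exact (wordLength_inv_le _).trans (wordLength_z_pow_le _)

theorem a_mul_b_zpow (j : ℤ) : a * b ^ j = b ^ j * a * z ^ j := by
  have h : a * b * a⁻¹ = b * z := by
    rw [a_mul_b, ← (z_commute b).eq, mul_assoc, mul_assoc, mul_inv_cancel, mul_one]
  have h2 : a * b ^ j * a⁻¹ = b ^ j * z ^ j := by
    rw [← conj_zpow, h, (z_commute b).symm.mul_zpow]
  rw [mul_assoc, ← ((z_commute a).zpow_left j).eq, ← mul_assoc, ← h2, inv_mul_cancel_right]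

/-- Only moving a past b^j creates a central factor, namely z^j. With b placed before a, the
exponents are exactly the coordinates (`coords_normal_form`). -/
theorem exists_normal_form (x : DiscreteHeisenberg) :
    ∃ i j k : ℤ, x = b ^ j * a ^ i * z ^ k := by
  have ha : ∀ i j k : ℤ, a * (b ^ j * a ^ i * z ^ k) = b ^ j * a ^ (i + 1) * z ^ (k + j) := by
    intro i j k
    have hz := ((z_commute (a ^ i)).zpow_left j).eq
    calc a * (b ^ j * a ^ i * z ^ k) = a * b ^ j * (a ^ i * z ^ k) := by simp only [mul_assoc]
      _ = b ^ j * a * (z ^ j * a ^ i) * z ^ k := by rw [a_mul_b_zpow]; simp only [mul_assoc]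
      _ = _ := by
        rw [hz, add_comm i, add_comm k, zpow_add a, zpow_add z, zpow_one]; simp only [mul_assoc]
  obtain ⟨l, hl, rfl, -⟩ := exists_word_length_eq x
  induction l with
  | nil => exact ⟨0, 0, 0, by simp⟩
  | cons g l ih =>
    obtain ⟨i, j, k, h⟩ := ih fun x hx => hl x (List.mem_cons_of_mem _ hx)
    rw [List.prod_cons, h]
    have hg : g ∈ gens := hl g List.mem_cons_self
    rcases hg with rfl | rfl | rfl | rfl
    · exact ⟨i + 1, j, k + j, ha i j k⟩
    · exact ⟨i, 1 + j, k, by rw [zpow_add b, zpow_one]; simp only [mul_assoc]⟩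
    · refine ⟨i - 1, j, k - j, ?_⟩
      rw [inv_mul_eq_iff_eq_mul, ha]
      simp
    · exact ⟨i, -1 + j, k, by rw [zpow_add b, zpow_neg_one]; simp only [mul_assoc]⟩

/-- The condition `hv` kills the quadratic term of the group law along the powers of x. -/
theorem coords_zpow_line {x : DiscreteHeisenberg} {v : ℝ × ℝ × ℝ} (hx : coords x = v)
    (hv : v.1 * v.2.1 = 0) (n : ℤ) : coords (x ^ n) = (n : ℝ) • v := by
  have key : ∀ n : ℤ, heisMul ((n : ℝ) • v) v = ((n + 1 : ℤ) : ℝ) • v := by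
    intro n
    simp only [heisMul, Prod.ext_iff, Prod.smul_fst, Prod.smul_snd, smul_eq_mul, Int.cast_add,
      Int.cast_one]
    refine ⟨by ring, by ring, by linear_combination (n : ℝ) * hv⟩
  induction n using Int.induction_on with
  | zero => simp [coords_one]
  | succ n ih => rw [zpow_add_one, coords_mul, ih, hx, key]
  | pred n ih =>
    rw [zpow_sub_one, coords_mul, ih, coords_inv, hx]
    have h := key (-n - 1)
    rw [sub_add_cancel] at h
    rw [← h, heisMul_assoc, heisMul_heisInv, heisMul_zero]

theorem coords_z : coords z = (0, 0, 1) := by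
  rw [z, commutatorElement_def]
  simp [coords_mul, coords_inv, coords_a, coords_b, heisMul, heisInv]

theorem coords_normal_form (i j k : ℤ) :
    coords (b ^ j * a ^ i * z ^ k) = ((i : ℝ), (j : ℝ), (k : ℝ)) := by
  rw [coords_mul, coords_mul, coords_zpow_line coords_a (by simp),
    coords_zpow_line coords_b (by simp), coords_zpow_line coords_z (by simp)]
  simp [heisMul]

theorem wordLength_le_heisGauge (x : DiscreteHeisenberg) :
    (wordLength x : ℝ) ≤ 12 * heisGauge (coords x) := by
  obtain ⟨i, j, k, rfl⟩ := exists_normal_form x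
  rw [coords_normal_form]
  have h1 := wordLength_mul_le (b ^ j * a ^ i) (z ^ k)
  have h2 := wordLength_mul_le (b ^ j) (a ^ i)
  have h3 := wordLength_gen_zpow_le a_mem_gens i
  have h4 := wordLength_gen_zpow_le b_mem_gens j
  have h5 := wordLength_z_zpow_le k
  have h : wordLength (b ^ j * a ^ i * z ^ k) ≤
      j.natAbs + i.natAbs + 10 * k.natAbs.sqrt := by omega
  have hc : (wordLength (b ^ j * a ^ i * z ^ k) : ℝ) ≤
      |(j : ℝ)| + |(i : ℝ)| + 10 * (k.natAbs.sqrt : ℝ) := by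
    have : ((wordLength (b ^ j * a ^ i * z ^ k) : ℕ) : ℝ) ≤
      ((j.natAbs + i.natAbs + 10 * k.natAbs.sqrt : ℕ) : ℝ) := by exact_mod_cast h
    push_cast [Nat.cast_natAbs] at this
    exact this
  have hk : (k.natAbs.sqrt : ℝ) ≤ √|(k : ℝ)| := by
    have := Real.nat_sqrt_le_real_sqrt (a := k.natAbs)
    rwa [Nat.cast_natAbs, Int.cast_abs] at this
  have m1 : |(i : ℝ)| ≤ heisGauge ((i : ℝ), (j : ℝ), (k : ℝ)) := le_max_left _ _
  have m2 : |(j : ℝ)| ≤ heisGauge ((i : ℝ), (j : ℝ), (k : ℝ)) :=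
    (le_max_left _ _).trans (le_max_right _ _)
  have m3 : √|(k : ℝ)| ≤ heisGauge ((i : ℝ), (j : ℝ), (k : ℝ)) :=
    (le_max_right _ _).trans (le_max_right _ _)
  linarith

end DiscreteHeisenberg

/-! ### Dilations, bi-invariance of Lebesgue measure, and volume packing. -/

/-- The Heisenberg dilations. -/
def heisDil (t : ℝ) (x : ℝ × ℝ × ℝ) : ℝ × ℝ × ℝ := (t * x.1, t * x.2.1, t ^ 2 * x.2.2)

theorem heisDil_heisMul (t : ℝ) (x y : ℝ × ℝ × ℝ) :
    heisDil t (heisMul x y) = heisMul (heisDil t x) (heisDil t y) := by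
  simp only [heisDil, heisMul, Prod.mk.injEq]
  refine ⟨by ring, by ring, by ring⟩

theorem heisDil_heisInv (t : ℝ) (x : ℝ × ℝ × ℝ) :
    heisDil t (heisInv x) = heisInv (heisDil t x) := by
  simp only [heisDil, heisInv, Prod.mk.injEq]
  refine ⟨by ring, by ring, by ring⟩

theorem heisDil_heisDil (s t : ℝ) (x : ℝ × ℝ × ℝ) :
    heisDil s (heisDil t x) = heisDil (s * t) x := by
  simp only [heisDil, Prod.mk.injEq]
  refine ⟨by ring, by ring, by ring⟩

theorem heisGauge_heisDil {t : ℝ} (ht : 0 ≤ t) (x : ℝ × ℝ × ℝ) :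
    heisGauge (heisDil t x) = t * heisGauge x := by
  simp only [heisGauge, heisDil, abs_mul, abs_of_nonneg ht, abs_of_nonneg (sq_nonneg t),
    Real.sqrt_mul (sq_nonneg t), Real.sqrt_sq ht, mul_max_of_nonneg _ _ ht]

theorem continuous_heisMul : Continuous fun z : (ℝ × ℝ × ℝ) × (ℝ × ℝ × ℝ) => heisMul z.1 z.2 := by
  unfold heisMul
  fun_prop

theorem continuous_heisDil : Continuous fun z : ℝ × (ℝ × ℝ × ℝ) => heisDil z.1 z.2 := by
  unfold heisDil
  fun_prop

theorem continuous_heisMul_left (x : ℝ × ℝ × ℝ) : Continuous (heisMul x) := by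
  unfold heisMul
  fun_prop

theorem continuous_heisMul_right (x : ℝ × ℝ × ℝ) : Continuous fun h => heisMul h x := by
  unfold heisMul
  fun_prop

theorem continuous_heisGauge : Continuous heisGauge := by
  unfold heisGauge
  fun_prop

theorem measurePreserving_heisMul_left (x : ℝ × ℝ × ℝ) :
    MeasurePreserving (heisMul x) volume volume := by
  have h2 : MeasurePreserving
      (fun w : ℝ × ℝ => (x.2.1 + w.1, x.2.2 + w.2 + x.1 * w.1)) volume volume :=
    (measurePreserving_add_left volume x.2.1).skew_product
      (g := fun u v => x.2.2 + v + x.1 * u) (by fun_prop)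
      (Filter.Eventually.of_forall fun u => by
        have : (fun v : ℝ => x.2.2 + v + x.1 * u) = fun v => (x.2.2 + x.1 * u) + v := by
          ext v; ring
        rw [this]
        exact map_add_left_eq_self _ _)
  exact (measurePreserving_add_left volume x.1).prod h2

theorem measurePreserving_heisMul_right (x : ℝ × ℝ × ℝ) :
    MeasurePreserving (fun h => heisMul h x) volume volume := by
  refine (measurePreserving_add_right volume x.1).skew_product
    (g := fun (u : ℝ) (w : ℝ × ℝ) => (w.1 + x.2.1, w.2 + x.2.2 + u * x.2.1)) (by fun_prop)
    (Filter.Eventually.of_forall fun u => ?_)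
  have : (fun w : ℝ × ℝ => (w.1 + x.2.1, w.2 + x.2.2 + u * x.2.1)) =
      fun w => w + (x.2.1, x.2.2 + u * x.2.1) := by
    ext w
    · simp
    · simp only [Prod.snd_add]; ring
  rw [this]
  exact map_add_right_eq_self _ _

/-- The homogeneous dimension is 4 = 1 + 1 + 2, the central coordinate being scaled by t². -/
theorem volume_preimage_heisDil {t : ℝ} (ht : 0 < t) {S : Set (ℝ × ℝ × ℝ)}
    (hS : MeasurableSet S) :
    volume (heisDil t ⁻¹' S) = ENNReal.ofReal (t⁻¹ ^ 4) * volume S := by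
  have h1 : Measure.map (fun u : ℝ => t * u) volume = ENNReal.ofReal t⁻¹ • volume := by
    rw [Real.map_volume_mul_left ht.ne', abs_of_pos (inv_pos.2 ht)]
  have h2 : Measure.map (fun u : ℝ => t ^ 2 * u) volume = ENNReal.ofReal (t⁻¹ ^ 2) • volume := by
    rw [Real.map_volume_mul_left (pow_pos ht 2).ne', abs_of_pos (inv_pos.2 (pow_pos ht 2)),
      inv_pow]
  have h3 : Measure.map (heisDil t) volume = ENNReal.ofReal (t⁻¹ ^ 4) • volume := by
    have e : heisDil t = Prod.map (fun u : ℝ => t * u)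
        (Prod.map (fun u : ℝ => t * u) (fun u : ℝ => t ^ 2 * u)) := rfl
    rw [e, Measure.volume_eq_prod, Measure.volume_eq_prod,
      ← Measure.map_prod_map _ _ (by fun_prop) (by fun_prop),
      ← Measure.map_prod_map _ _ (by fun_prop) (by fun_prop), h1, h2,
      Measure.prod_smul_left, Measure.prod_smul_left, Measure.prod_smul_right,
      Measure.prod_smul_right, Measure.prod_smul_right, smul_smul, smul_smul,
      ← ENNReal.ofReal_mul (by positivity), ← ENNReal.ofReal_mul (by positivity)]
    congr 2
    ring
  have hm : Measurable (heisDil t) := by unfold heisDil; fun_prop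
  rw [← Measure.map_apply hm hS, h3, Measure.smul_apply, smul_eq_mul]

/-- In the Heisenberg group with a homogeneous symmetric subadditive gauge, volumes bound the
cardinality of a separated subset of a ball. -/
theorem card_le_of_separated {M : ℝ × ℝ × ℝ → ℝ} {κ c₁ c₂ : ℝ} (hκ : 0 < κ)
    (hM : Measurable M) (hdil : ∀ t, 0 < t → ∀ x, M (heisDil t x) = t ^ κ * M x)
    (hsymm : ∀ x, M (heisInv x) = M x) (hsub : ∀ x y, M (heisMul x y) ≤ M x + M y)
    (hc₁ : 0 < c₁) (hlow : ∀ x, c₁ * heisGauge x ^ κ ≤ M x)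
    (hup : ∀ x, M x ≤ c₂ * heisGauge x ^ κ)
    {s : Finset (ℝ × ℝ × ℝ)} {R t : ℝ} (hR : 0 ≤ R) (ht : 0 < t) {x₀ : ℝ × ℝ × ℝ}
    (hs : ∀ y ∈ s, M (heisMul (heisInv x₀) y) ≤ R)
    (hsep : ∀ y ∈ s, ∀ y' ∈ s, y ≠ y' → t ≤ M (heisMul (heisInv y) y')) :
    (s.card : ℝ) ≤ (1 + 2 * R / t) ^ (4 / κ) := by
  set B : ℝ → Set (ℝ × ℝ × ℝ) := fun r => {x | M x < r} with hB
  have hBm : ∀ r, MeasurableSet (B r) := fun r => measurableSet_lt hM measurable_const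
  have hvol : ∀ r, 0 < r → volume (B r) = ENNReal.ofReal (r ^ (4 / κ)) * volume (B 1) := by
    intro r hr
    have hl : 0 < r ^ (-1 / κ) := Real.rpow_pos_of_pos hr _
    have e : B r = heisDil (r ^ (-1 / κ)) ⁻¹' B 1 := by
      ext x
      simp only [hB, Set.mem_ofPred_eq, Set.mem_preimage]
      rw [hdil _ hl, ← Real.rpow_mul hr.le, div_mul_cancel₀ _ hκ.ne', Real.rpow_neg_one,
        inv_mul_lt_iff₀ hr, mul_one]
    rw [e, volume_preimage_heisDil hl (hBm 1)]
    congr 2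
    rw [← Real.rpow_neg hr.le, ← Real.rpow_natCast, ← Real.rpow_mul hr.le]
    congr 1
    push_cast
    ring
  -- The upper gauge bound puts an open neighbourhood of 0 inside the unit ball; below, the lower
  -- bound makes that ball bounded.
  have hpos : volume (B 1) ≠ 0 := by
    set O : Set (ℝ × ℝ × ℝ) := {x | c₂ * heisGauge x ^ κ < 1}
    have hO : IsOpen O := by
      refine isOpen_lt ?_ continuous_const
      exact continuous_const.mul (continuous_heisGauge.rpow_const fun _ => Or.inr hκ.le)
    have h0 : (0 : ℝ × ℝ × ℝ) ∈ O := by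
      simp [O, heisGauge, Real.zero_rpow hκ.ne']
    have hOB : O ⊆ B 1 := fun x hx => (hup x).trans_lt hx
    exact ((hO.measure_pos volume ⟨0, h0⟩).trans_le (measure_mono hOB)).ne'
  have hfin : volume (B 1) ≠ ∞ := by
    set L : ℝ := max 1 ((1 / c₁) ^ (1 / κ))
    have hBL : B 1 ⊆ Metric.closedBall 0 (L ^ 2) := by
      intro x hx
      have h1 : heisGauge x ^ κ ≤ 1 / c₁ := by
        rw [le_div_iff₀' hc₁]
        exact (hlow x).trans (le_of_lt hx)
      have h2 : heisGauge x ≤ L := by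
        refine le_trans ?_ (le_max_right _ _)
        rw [one_div κ]
        exact (Real.le_rpow_inv_iff_of_pos (heisGauge_nonneg x) (by positivity) hκ).2 h1
      have hL : 1 ≤ L := le_max_left _ _
      have hL2 : L ≤ L ^ 2 := by nlinarith
      obtain ⟨a1, a2, a3⟩ := (heisGauge_le_iff (by linarith)).1 h2
      rw [mem_closedBall_zero_iff, Prod.norm_def, Prod.norm_def]
      exact max_le (a1.trans hL2) (max_le (a2.trans hL2) a3)
    exact (measure_mono hBL).trans_lt (isCompact_closedBall _ _).measure_lt_top |>.ne
  -- Packing: the left translates of the ball of radius t/2 centred at the points of `s` are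
  -- disjoint and lie in the ball of radius R + t/2 about `x₀`.
  have hcard : (s.card : ℝ≥0∞) * volume (B (t / 2)) ≤ volume (B (R + t / 2)) := by
    have hdisj : Set.PairwiseDisjoint (↑s : Set (ℝ × ℝ × ℝ))
        fun y => heisMul (heisInv y) ⁻¹' B (t / 2) := by
      intro y hy y' hy' hne
      rw [Function.onFun, Set.disjoint_left]
      intro w (hw : M _ < t / 2) (hw' : M _ < t / 2)
      have h1 := hsep y hy y' hy' hne
      have h2 : heisMul (heisInv y) y' =
          heisMul (heisMul (heisInv y) w) (heisInv (heisMul (heisInv y') w)) := by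
        rw [heisInv_heisMul_rev, heisInv_heisInv, heisMul_assoc, ← heisMul_assoc w,
          heisMul_heisInv, zero_heisMul]
      rw [h2] at h1
      have h3 := hsub (heisMul (heisInv y) w) (heisInv (heisMul (heisInv y') w))
      rw [hsymm] at h3
      linarith
    have hsum := measure_biUnion_finset (μ := volume) hdisj
      fun y _ => (continuous_heisMul_left (heisInv y)).measurable (hBm (t / 2))
    have hterm : ∀ y ∈ s, volume (heisMul (heisInv y) ⁻¹' B (t / 2)) = volume (B (t / 2)) :=
      fun y _ => (measurePreserving_heisMul_left (heisInv y)).measure_preimage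
        (hBm _).nullMeasurableSet
    rw [Finset.sum_congr rfl hterm, Finset.sum_const, nsmul_eq_mul] at hsum
    rw [← hsum, ← (measurePreserving_heisMul_left (heisInv x₀)).measure_preimage
        (hBm _).nullMeasurableSet]
    refine measure_mono (Set.iUnion₂_subset fun y hy w (hw : M _ < t / 2) => ?_)
    have h2 : heisMul (heisInv x₀) w =
        heisMul (heisMul (heisInv x₀) y) (heisMul (heisInv y) w) := by
      rw [heisMul_assoc, ← heisMul_assoc y, heisMul_heisInv, zero_heisMul]
    change M (heisMul (heisInv x₀) w) < R + t / 2
    rw [h2]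
    exact (hsub _ _).trans_lt (add_lt_add_of_le_of_lt (hs y hy) hw)
  rw [hvol (t / 2) (by positivity), hvol (R + t / 2) (by positivity), ← mul_assoc,
    ENNReal.mul_le_mul_iff_left hpos hfin, ← ENNReal.ofReal_natCast,
    ← ENNReal.ofReal_mul (Nat.cast_nonneg _),
    ENNReal.ofReal_le_ofReal_iff (by positivity)] at hcard
  have ht2 : 0 < t / 2 := by positivity
  have e : 1 + 2 * R / t = (R + t / 2) / (t / 2) := by field_simp; ring
  rw [e, Real.div_rpow (by positivity) ht2.le, le_div_iff₀ (by positivity)]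
  exact hcard

/-! ### Snowflakes of the line in `L_p(ℝ)`. -/

theorem lintegral_comp_mul_left_of_pos {f : ℝ → ℝ≥0∞} (hf : Measurable f) {d : ℝ} (hd : 0 < d) :
    ∫⁻ u, f u = ENNReal.ofReal d * ∫⁻ u, f (d * u) := by
  have h := Real.smul_map_volume_mul_left hd.ne'
  rw [abs_of_pos hd] at h
  conv_lhs => rw [← h]
  rw [lintegral_smul_measure, lintegral_map hf (by fun_prop), smul_eq_mul]

theorem enorm_rpow_eq_ofReal {x p : ℝ} (hp : 0 ≤ p) :
    ‖x‖ₑ ^ p = ENNReal.ofReal (|x| ^ p) := by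
  rw [Real.enorm_eq_ofReal_abs, ENNReal.ofReal_rpow_of_nonneg (abs_nonneg _) hp]

/-- Since β < 1, (1 + 1/u)^β ≤ 1 + 1/u. This is the tail decay that makes the p-th power integrable
when (β - 1)p < -1. -/
theorem posPart_rpow_add_one_sub_le {β : ℝ} (hβ : 0 < β) (hβ1 : β < 1) {u : ℝ} (hu : 0 < u) :
    |max (u + 1) 0 ^ β - max u 0 ^ β| ≤ u ^ (β - 1) := by
  rw [max_eq_left hu.le, max_eq_left (by linarith),
    abs_of_nonneg (sub_nonneg.2 (Real.rpow_le_rpow hu.le (by linarith) hβ.le)),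
    Real.rpow_sub_one hu.ne', sub_le_iff_le_add]
  have h1 : u + 1 = u * (1 + 1 / u) := by field_simp
  have h2 : 1 ≤ 1 + 1 / u := le_add_of_nonneg_right (by positivity)
  rw [h1, Real.mul_rpow hu.le (by linarith)]
  calc u ^ β * (1 + 1 / u) ^ β ≤ u ^ β * (1 + 1 / u) := by
        gcongr
        simpa using Real.rpow_le_rpow_of_exponent_le h2 hβ1.le
    _ = _ := by ring

theorem lintegral_posPart_rpow_lt_top {β p : ℝ} (hβ : 0 < β) (hβ1 : β < 1) (hp : 0 < p)
    (hβp : (β - 1) * p < -1) :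
    ∫⁻ u : ℝ, ‖max (u + 1) 0 ^ β - max u 0 ^ β‖ₑ ^ p < ∞ := by
  have hle : ∀ u : ℝ, ‖max (u + 1) 0 ^ β - max u 0 ^ β‖ₑ ^ p ≤
      (Set.Icc (-1 : ℝ) 1).indicator (fun _ => ENNReal.ofReal (2 ^ p)) u +
      (Set.Ioi (1 : ℝ)).indicator (fun u => ENNReal.ofReal (u ^ ((β - 1) * p))) u := by
    intro u
    rw [enorm_rpow_eq_ofReal hp.le]
    rcases lt_or_ge 1 u with h1 | h1
    · rw [Set.indicator_of_mem (show u ∈ Set.Ioi (1 : ℝ) from h1)]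
      refine le_add_left (ENNReal.ofReal_le_ofReal ?_)
      rw [Real.rpow_mul (by linarith)]
      exact Real.rpow_le_rpow (abs_nonneg _)
        (posPart_rpow_add_one_sub_le hβ hβ1 (by linarith)) hp.le
    · rcases le_or_gt (-1) u with h2 | h2
      · rw [Set.indicator_of_mem (show u ∈ Set.Icc (-1 : ℝ) 1 from ⟨h2, h1⟩)]
        refine le_add_right (ENNReal.ofReal_le_ofReal ?_)
        refine Real.rpow_le_rpow (abs_nonneg _) ?_ hp.le
        have h3 : max (u + 1) 0 ^ β ≤ 2 := by
          calc max (u + 1) 0 ^ β ≤ 2 ^ β :=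
                Real.rpow_le_rpow (le_max_right _ _) (max_le (by linarith) (by norm_num)) hβ.le
            _ ≤ 2 ^ (1 : ℝ) := Real.rpow_le_rpow_of_exponent_le (by norm_num) hβ1.le
            _ = 2 := Real.rpow_one 2
        have h4 : 0 ≤ max u 0 ^ β := Real.rpow_nonneg (le_max_right _ _) _
        have h5 : max u 0 ^ β ≤ max (u + 1) 0 ^ β :=
          Real.rpow_le_rpow (le_max_right _ _) (max_le_max (by linarith) le_rfl) hβ.le
        rw [abs_of_nonneg (by linarith)]
        linarith
      · rw [max_eq_right (by linarith), max_eq_right (by linarith), sub_self, abs_zero,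
          Real.zero_rpow hp.ne', ENNReal.ofReal_zero]
        exact zero_le
  refine (lintegral_mono hle).trans_lt ?_
  rw [lintegral_add_left (measurable_const.indicator measurableSet_Icc),
    lintegral_indicator measurableSet_Icc, lintegral_indicator measurableSet_Ioi]
  refine ENNReal.add_lt_top.2 ⟨?_, ?_⟩
  · rw [setLIntegral_const]
    exact ENNReal.mul_lt_top ENNReal.ofReal_lt_top (by simp)
  · exact (integrableOn_Ioi_rpow_of_lt hβp one_pos).lintegral_lt_top

theorem lintegral_posPart_rpow_ne_zero {β : ℝ} (hβ : 0 < β) (p : ℝ) :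
    ∫⁻ u : ℝ, ‖max (u + 1) 0 ^ β - max u 0 ^ β‖ₑ ^ p ≠ 0 := by
  rw [← pos_iff_ne_zero, lintegral_pos_iff_support (by fun_prop)]
  have hsub : Set.Ioo (-1 : ℝ) 0 ⊆
      Function.support fun u : ℝ => ‖max (u + 1) 0 ^ β - max u 0 ^ β‖ₑ ^ p := by
    intro u hu
    rw [Function.mem_support, max_eq_right hu.2.le, max_eq_left (by linarith [hu.1]),
      Real.zero_rpow hβ.ne', sub_zero]
    have : 0 < (u + 1) ^ β := Real.rpow_pos_of_pos (by linarith [hu.1]) _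
    simp [this.ne']
  exact lt_of_lt_of_le (by simp) (measure_mono hsub)

/-- The snowflake `|a - b| ^ (β + 1 / p)` of the real line embeds isometrically in `L_p(ℝ)` by
translates of a single function. -/
theorem exists_snowflake {β p : ℝ} (hβ : 0 < β) (hβ1 : β < 1) (hp : 0 < p)
    (hβp : (β - 1) * p < -1) :
    ∃ g : ℝ → ℝ, Measurable g ∧
      ∀ a b : ℝ, ∫⁻ u, ‖g (u + a) - g (u + b)‖ₑ ^ p = ‖a - b‖ₑ ^ (β * p + 1) := by
  set c : ℝ≥0∞ := ∫⁻ u : ℝ, ‖max (u + 1) 0 ^ β - max u 0 ^ β‖ₑ ^ p with hc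
  have hc0 : c ≠ 0 := lintegral_posPart_rpow_ne_zero hβ p
  have hct : c ≠ ∞ := (lintegral_posPart_rpow_lt_top hβ hβ1 hp hβp).ne
  have key : ∀ a b : ℝ, b < a →
      ∫⁻ u : ℝ, ‖max (u + a) 0 ^ β - max (u + b) 0 ^ β‖ₑ ^ p = c * ‖a - b‖ₑ ^ (β * p + 1) := by
    intro a b hab
    have hd : 0 < a - b := sub_pos.2 hab
    -- The substitution (a - b)u - b reduces to increment 1: homogeneity gives (a - b)^(βp) and the
    -- Jacobian one more factor a - b.
    rw [← lintegral_add_right_eq_self _ (-b), lintegral_comp_mul_left_of_pos (by fun_prop) hd]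
    have h1 : ∀ u : ℝ, ‖max ((a - b) * u + -b + a) 0 ^ β - max ((a - b) * u + -b + b) 0 ^ β‖ₑ ^ p
        = ENNReal.ofReal ((a - b) ^ (β * p)) * ‖max (u + 1) 0 ^ β - max u 0 ^ β‖ₑ ^ p := by
      intro u
      have e1 : max ((a - b) * u + -b + a) 0 = (a - b) * max (u + 1) 0 := by
        rw [mul_max_of_nonneg _ _ hd.le, mul_zero]; congr 1; ring
      have e2 : max ((a - b) * u + -b + b) 0 = (a - b) * max u 0 := by
        rw [mul_max_of_nonneg _ _ hd.le, mul_zero]; congr 1; ring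
      rw [e1, e2, Real.mul_rpow hd.le (le_max_right _ _), Real.mul_rpow hd.le (le_max_right _ _),
        ← mul_sub, enorm_mul, ENNReal.mul_rpow_of_nonneg _ _ hp.le, enorm_rpow_eq_ofReal hp.le,
        abs_of_nonneg (Real.rpow_nonneg hd.le _), ← Real.rpow_mul hd.le]
    simp_rw [h1]
    rw [lintegral_const_mul _ (by fun_prop), ← hc, ← mul_assoc,
      ← ENNReal.ofReal_mul hd.le, mul_comm c, enorm_rpow_eq_ofReal (by positivity), abs_of_pos hd,
      Real.rpow_add_one hd.ne', mul_comm (a - b)]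
  set k : ℝ := (c.toReal) ^ (-1 / p)
  have hcr : 0 < c.toReal := ENNReal.toReal_pos hc0 hct
  have hk : ‖k‖ₑ ^ p * c = 1 := by
    rw [enorm_rpow_eq_ofReal hp.le, abs_of_pos (Real.rpow_pos_of_pos hcr _),
      ← Real.rpow_mul hcr.le, div_mul_cancel₀ _ hp.ne', Real.rpow_neg_one,
      ENNReal.ofReal_inv_of_pos hcr, ENNReal.ofReal_toReal hct, ENNReal.inv_mul_cancel hc0 hct]
  have key2 : ∀ a b : ℝ, b < a → ∫⁻ u : ℝ, ‖k * max (u + a) 0 ^ β - k * max (u + b) 0 ^ β‖ₑ ^ p =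
      ‖a - b‖ₑ ^ (β * p + 1) := by
    intro a b hab
    simp_rw [← mul_sub, enorm_mul, ENNReal.mul_rpow_of_nonneg _ _ hp.le]
    rw [lintegral_const_mul _ (by fun_prop), key a b hab, ← mul_assoc, hk, one_mul]
  refine ⟨fun u => k * max u 0 ^ β, by fun_prop, fun a b => ?_⟩
  rcases lt_trichotomy a b with h | rfl | h
  · rw [enorm_sub_rev a b, ← key2 b a h]
    simp_rw [enorm_sub_rev]
  · simp only [sub_self, enorm_zero]
    rw [ENNReal.zero_rpow_of_pos hp, ENNReal.zero_rpow_of_pos (by positivity), lintegral_zero]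
  · exact key2 a b h

/-! ### Transfer to `L_p([0,1])`. -/

/-- Every `L_p` space of a σ-finite measure on a standard Borel space embeds isometrically in
`L_p([0,1])`. -/
theorem exists_isometric_LpUnit {X : Type*} [MeasurableSpace X] [StandardBorelSpace X] [Nonempty X]
    (μ : Measure X) [SigmaFinite μ] {p : ℝ} (hp : 0 < p) [Fact (1 ≤ ENNReal.ofReal p)] :
    ∃ Φ : (X → ℝ) → LpUnit p, ∀ f g : X → ℝ, Measurable f → Measurable g →
      ∫⁻ x, ‖f x‖ₑ ^ p ∂μ ≠ ∞ → ∫⁻ x, ‖g x‖ₑ ^ p ∂μ ≠ ∞ →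
      ‖Φ f - Φ g‖ₑ ^ p = ∫⁻ x, ‖f x - g x‖ₑ ^ p ∂μ := by
  rcases eq_or_ne μ 0 with rfl | hμ
  · exact ⟨fun _ => 0, fun f g _ _ _ _ => by simp [hp]⟩
  -- A positive integrable weight, normalised to v, replaces μ by an equivalent probability measure
  -- ν; multiplying functions by v^(-1/p) compensates.
  obtain ⟨w, hw0, hwm, hw1⟩ := exists_pos_lintegral_lt_of_sigmaFinite μ one_ne_zero
  set c : ℝ≥0∞ := ∫⁻ x, w x ∂μ with hc
  have hct : c ≠ ∞ := (hw1.trans ENNReal.one_lt_top).ne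
  have hc0 : c ≠ 0 := by
    rw [hc, ← pos_iff_ne_zero, lintegral_pos_iff_support (by fun_prop)]
    have : (Function.support fun x => (w x : ℝ≥0∞)) = Set.univ := by
      ext x; simp [(hw0 x).ne']
    rw [this]
    exact Measure.measure_univ_pos.2 hμ
  set v : X → ℝ := fun x => c.toReal⁻¹ * w x with hv
  have hcr : 0 < c.toReal := ENNReal.toReal_pos hc0 hct
  have hv0 : ∀ x, 0 < v x := fun x => mul_pos (inv_pos.2 hcr) (NNReal.coe_pos.2 (hw0 x))
  have hvm : Measurable v := by fun_prop
  set ν : Measure X := μ.withDensity fun x => ENNReal.ofReal (v x) with hν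
  have hprob : IsProbabilityMeasure ν := by
    constructor
    rw [hν, withDensity_apply _ MeasurableSet.univ, Measure.restrict_univ]
    simp_rw [hv, ENNReal.ofReal_mul (inv_pos.2 hcr).le, ENNReal.ofReal_coe_nnreal]
    rw [lintegral_const_mul _ (by fun_prop), ← hc, ENNReal.ofReal_inv_of_pos hcr,
      ENNReal.ofReal_toReal hct, ENNReal.inv_mul_cancel hc0 hct]
  -- Composition with any map pushing Lebesgue measure to ν preserves `L_p` norms; T need not be
  -- injective.
  obtain ⟨T, hTm, hT⟩ := ν.exists_measurable_map_eq
  set S : ℝ → X := fun t => T (Set.projIcc 0 1 zero_le_one t) with hS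
  have hSm : Measurable S := hTm.comp continuous_projIcc.measurable
  have hSν : (volume.restrict (Set.Icc (0 : ℝ) 1)).map S = ν := by
    rw [← unitInterval.measurePreserving_coe.map_eq, Measure.map_map hSm measurable_subtype_coe,
      ← hT]
    congr 1
    ext t
    simp [hS]
  set L : (X → ℝ) → ℝ → ℝ := fun f t => f (S t) * v (S t) ^ (-1 / p) with hL
  have hLm : ∀ f, Measurable f → Measurable (L f) := fun f hf => by
    have := hf.comp hSm
    have := hvm.comp hSm
    fun_prop
  have hLint : ∀ f, Measurable f →
      ∫⁻ t, ‖L f t‖ₑ ^ p ∂(volume.restrict (Set.Icc (0 : ℝ) 1)) = ∫⁻ x, ‖f x‖ₑ ^ p ∂μ := by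
    intro f hf
    have h1 : ∫⁻ t, ‖L f t‖ₑ ^ p ∂(volume.restrict (Set.Icc (0 : ℝ) 1)) =
        ∫⁻ x, ‖f x * v x ^ (-1 / p)‖ₑ ^ p ∂ν := by
      rw [← hSν, lintegral_map (by fun_prop) hSm]
    rw [h1, hν, lintegral_withDensity_eq_lintegral_mul _ (by fun_prop) (by fun_prop)]
    refine lintegral_congr fun x => ?_
    rw [Pi.mul_apply, enorm_mul, ENNReal.mul_rpow_of_nonneg _ _ hp.le,
      enorm_rpow_eq_ofReal (x := v x ^ (-1 / p)) hp.le,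
      abs_of_pos (Real.rpow_pos_of_pos (hv0 x) _), ← Real.rpow_mul (hv0 x).le,
      div_mul_cancel₀ _ hp.ne', Real.rpow_neg_one, ENNReal.ofReal_inv_of_pos (hv0 x), mul_left_comm,
      ENNReal.mul_inv_cancel (ENNReal.ofReal_pos.2 (hv0 x)).ne' ENNReal.ofReal_ne_top, mul_one]
  have hp0 : ENNReal.ofReal p ≠ 0 := (ENNReal.ofReal_pos.2 hp).ne'
  have hnorm : ∀ f : ℝ → ℝ,
      eLpNorm f (ENNReal.ofReal p) (volume.restrict (Set.Icc (0 : ℝ) 1)) ^ p =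
        ∫⁻ t, ‖f t‖ₑ ^ p ∂(volume.restrict (Set.Icc (0 : ℝ) 1)) := by
    intro f
    rw [eLpNorm_eq_lintegral_rpow_enorm_toReal hp0 ENNReal.ofReal_ne_top,
      ENNReal.toReal_ofReal hp.le, ← ENNReal.rpow_mul, one_div_mul_cancel hp.ne',
      ENNReal.rpow_one]
  have hmem : ∀ f, Measurable f → ∫⁻ x, ‖f x‖ₑ ^ p ∂μ ≠ ∞ →
      MemLp (L f) (ENNReal.ofReal p) (volume.restrict (Set.Icc (0 : ℝ) 1)) := by
    intro f hf hfin
    refine ⟨(hLm f hf).aestronglyMeasurable, ?_⟩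
    rw [← hLint f hf, ← hnorm] at hfin
    exact lt_top_iff_ne_top.2 fun h => hfin (by rw [h, ENNReal.top_rpow_of_pos hp])
  classical
  refine ⟨fun f => if h : MemLp (L f) (ENNReal.ofReal p) (volume.restrict (Set.Icc (0 : ℝ) 1))
    then h.toLp else 0, fun f g hf hg hff hgf => ?_⟩
  beta_reduce
  rw [dif_pos (hmem f hf hff), dif_pos (hmem g hg hgf), ← MemLp.toLp_sub, Lp.enorm_toLp, hnorm,
    ← hLint (fun x => f x - g x) (hf.sub hg)]
  simp only [hL, Pi.sub_apply, sub_mul]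

/-! ### Translates of a bump function at a single scale. -/

/-- A tent function on `ℝ³`. -/
noncomputable def bump (h : ℝ × ℝ × ℝ) : ℝ := max 0 (1 - ‖h‖)

theorem continuous_bump : Continuous bump := by
  unfold bump
  fun_prop

theorem bump_nonneg (h : ℝ × ℝ × ℝ) : 0 ≤ bump h := le_max_left _ _

theorem bump_le_one (h : ℝ × ℝ × ℝ) : bump h ≤ 1 :=
  max_le zero_le_one (by linarith [norm_nonneg h])

theorem bump_eq_zero {h : ℝ × ℝ × ℝ} (hh : 1 ≤ ‖h‖) : bump h = 0 :=
  max_eq_left (by linarith)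

theorem abs_bump_sub_le_one (h k : ℝ × ℝ × ℝ) : |bump h - bump k| ≤ 1 :=
  abs_sub_le_iff.2 ⟨by linarith [bump_le_one h, bump_nonneg k],
    by linarith [bump_le_one k, bump_nonneg h]⟩

theorem abs_bump_sub_le_norm (h k : ℝ × ℝ × ℝ) : |bump h - bump k| ≤ ‖h - k‖ := by
  refine (abs_max_sub_max_le_max 0 (1 - ‖h‖) 0 (1 - ‖k‖)).trans (max_le (by simp) ?_)
  rw [sub_sub_sub_cancel_left, abs_sub_comm]
  exact abs_norm_sub_norm_le h k

theorem volume_closedBall_zero (r : ℝ) (hr : 0 ≤ r) :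
    volume (Metric.closedBall (0 : ℝ × ℝ × ℝ) r) = ENNReal.ofReal ((2 * r) ^ 3) := by
  have h0 : (0 : ℝ × ℝ × ℝ) = ((0 : ℝ), ((0 : ℝ), (0 : ℝ))) := rfl
  rw [h0, ← closedBall_prod_same, ← closedBall_prod_same, Measure.volume_eq_prod,
    Measure.prod_prod, Measure.volume_eq_prod, Measure.prod_prod, Real.volume_closedBall,
    ← ENNReal.ofReal_mul (by positivity), ← ENNReal.ofReal_mul (by positivity)]
  congr 1
  ring

/-- The `q`-th power of the `L_q` distance between `bump` and its right translate by `x`. -/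
noncomputable def bumpDiff (q : ℝ) (x : ℝ × ℝ × ℝ) : ℝ≥0∞ :=
  ∫⁻ h, ‖bump (heisMul h x) - bump h‖ₑ ^ q

theorem measurable_bumpDiff (q : ℝ) : Measurable (bumpDiff q) := by
  have h1 : Measurable fun z : (ℝ × ℝ × ℝ) × (ℝ × ℝ × ℝ) => bump (heisMul z.2 z.1) :=
    (continuous_bump.comp (continuous_heisMul.comp continuous_swap)).measurable
  have h2 : Measurable fun z : (ℝ × ℝ × ℝ) × (ℝ × ℝ × ℝ) => bump z.2 :=
    (continuous_bump.comp continuous_snd).measurable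
  exact Measurable.lintegral_prod_right' (f := fun z : (ℝ × ℝ × ℝ) × (ℝ × ℝ × ℝ) =>
    ‖bump (heisMul z.2 z.1) - bump z.2‖ₑ ^ q) ((h1.sub h2).enorm.pow_const q)

/-- Right invariance of Lebesgue measure allows the substitution of h y⁻¹ for h, so the distance is
left-invariant in x and y. -/
theorem lintegral_bump_sub (q : ℝ) (x y : ℝ × ℝ × ℝ) :
    ∫⁻ h, ‖bump (heisMul h x) - bump (heisMul h y)‖ₑ ^ q = bumpDiff q (heisMul (heisInv y) x) := by
  have hm : ∀ z, Measurable fun h => ‖bump (heisMul h z) - bump h‖ₑ ^ q := fun z =>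
    ((continuous_bump.comp (continuous_heisMul_right z)).measurable.sub
      continuous_bump.measurable).enorm.pow_const q
  rw [bumpDiff, ← (measurePreserving_heisMul_right y).lintegral_comp (hm _)]
  refine lintegral_congr fun h => ?_
  rw [heisMul_assoc, ← heisMul_assoc y, heisMul_heisInv, zero_heisMul]

theorem bumpDiff_heisInv (q : ℝ) (x : ℝ × ℝ × ℝ) : bumpDiff q (heisInv x) = bumpDiff q x := by
  have h := lintegral_bump_sub q 0 x
  rw [heisMul_zero] at h
  rw [← h, bumpDiff]
  refine lintegral_congr fun h => ?_
  rw [enorm_sub_rev, heisMul_zero]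

theorem bumpDiff_zero {q : ℝ} (hq : 0 < q) : bumpDiff q 0 = 0 := by
  simp [bumpDiff, heisMul_zero, hq]

theorem bumpDiff_le_of_forall {q : ℝ} (hq : 0 < q) {x : ℝ × ℝ × ℝ} {B : ℝ}
    (hB : ∀ h : ℝ × ℝ × ℝ, ‖h‖ ≤ 1 ∨ ‖heisMul h x‖ ≤ 1 → |bump (heisMul h x) - bump h| ≤ B) :
    bumpDiff q x ≤ 16 * ENNReal.ofReal (B ^ q) := by
  set K : Set (ℝ × ℝ × ℝ) := Metric.closedBall 0 1
  set K' : Set (ℝ × ℝ × ℝ) := (fun h => heisMul h x) ⁻¹' K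
  have hK : MeasurableSet K := measurableSet_closedBall
  have hK' : MeasurableSet K' := (continuous_heisMul_right x).measurable hK
  have hvK : volume K = 8 := by
    rw [volume_closedBall_zero 1 zero_le_one]; norm_num
  have hvK' : volume K' = 8 := by
    rw [(measurePreserving_heisMul_right x).measure_preimage hK.nullMeasurableSet, hvK]
  have hle : ∀ h, ‖bump (heisMul h x) - bump h‖ₑ ^ q ≤
      (K ∪ K').indicator (fun _ => ENNReal.ofReal (B ^ q)) h := by
    intro h
    rw [enorm_rpow_eq_ofReal hq.le]
    by_cases hh : h ∈ K ∪ K'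
    · rw [Set.indicator_of_mem hh]
      refine ENNReal.ofReal_le_ofReal (Real.rpow_le_rpow (abs_nonneg _) (hB h ?_) hq.le)
      exact hh.imp mem_closedBall_zero_iff.1 mem_closedBall_zero_iff.1
    · rw [Set.indicator_of_notMem hh]
      have h1 : 1 ≤ ‖h‖ := by
        by_contra hc
        exact hh (Or.inl (mem_closedBall_zero_iff.2 (not_le.1 hc).le))
      have h2 : 1 ≤ ‖heisMul h x‖ := by
        by_contra hc
        exact hh (Or.inr (mem_closedBall_zero_iff.2 (not_le.1 hc).le))
      rw [bump_eq_zero h1, bump_eq_zero h2, sub_self, abs_zero, Real.zero_rpow hq.ne',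
        ENNReal.ofReal_zero]
  calc bumpDiff q x ≤ ∫⁻ h, (K ∪ K').indicator (fun _ => ENNReal.ofReal (B ^ q)) h :=
        lintegral_mono hle
    _ = ENNReal.ofReal (B ^ q) * volume (K ∪ K') :=
        lintegral_indicator_const (hK.union hK') _
    _ ≤ ENNReal.ofReal (B ^ q) * 16 := by
        gcongr
        refine (measure_union_le _ _).trans ?_
        rw [hvK, hvK']
        norm_num
    _ = _ := mul_comm _ _

theorem bumpDiff_le {q : ℝ} (hq : 0 < q) (x : ℝ × ℝ × ℝ) : bumpDiff q x ≤ 16 := by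
  simpa using bumpDiff_le_of_forall (B := 1) hq (x := x) fun h _ => abs_bump_sub_le_one _ _

/-- The bump is 1-Lipschitz. For gauge r < 1 and h or hx in the unit ball, |h₁| ≤ 2, so translation
by x moves h by at most max(r, r² + 2r) ≤ 3r. For r ≥ 1 the trivial bound 1 is enough. -/
theorem bumpDiff_le_gauge {q : ℝ} (hq : 0 < q) (x : ℝ × ℝ × ℝ) :
    bumpDiff q x ≤ 16 * ENNReal.ofReal ((3 * heisGauge x) ^ q) := by
  refine bumpDiff_le_of_forall hq fun h hh => ?_
  rcases le_or_gt 1 (heisGauge x) with h1 | h1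
  · exact (abs_bump_sub_le_one _ _).trans (by linarith)
  · refine (abs_bump_sub_le_norm _ _).trans ?_
    set r := heisGauge x
    have hr : 0 ≤ r := heisGauge_nonneg x
    obtain ⟨a1, a2, a3⟩ := (heisGauge_le_iff hr).1 le_rfl
    have hr2 : r ^ 2 ≤ r := by nlinarith
    have h2 : |h.1| ≤ 2 := by
      rcases hh with hh | hh
      · exact (norm_fst_le h).trans (hh.trans (by norm_num))
      · have h3 : |h.1 + x.1| ≤ 1 := (norm_fst_le (heisMul h x)).trans hh
        have h4 : |h.1| ≤ |h.1 + x.1| + |x.1| := by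
          simpa using abs_sub (h.1 + x.1) x.1
        linarith
    have e : heisMul h x - h = (x.1, x.2.1, x.2.2 + h.1 * x.2.1) := by
      simp only [heisMul, Prod.ext_iff, Prod.fst_sub, Prod.snd_sub]
      refine ⟨by ring, by ring, by ring⟩
    rw [e, Prod.norm_def, Prod.norm_def]
    refine max_le (a1.trans (by linarith)) (max_le (a2.trans (by linarith)) ?_)
    refine (abs_add_le _ _).trans ?_
    have h5 : |h.1 * x.2.1| ≤ 2 * r := by rw [abs_mul]; gcongr
    linarith

/-- Such a translation moves the ball of radius 1/2, where the bump is at least 1/2, off the open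
unit ball. In the sup norm this half ball has volume 1. -/
theorem le_bumpDiff {q : ℝ} (hq : 0 < q) {x : ℝ × ℝ × ℝ} (hx : 2 < heisGauge x) :
    ENNReal.ofReal ((1 / 2) ^ q) ≤ bumpDiff q x := by
  set K : Set (ℝ × ℝ × ℝ) := Metric.closedBall 0 (1 / 2)
  have hle : ∀ h, K.indicator (fun _ => ENNReal.ofReal ((1 / 2) ^ q)) h ≤
      ‖bump (heisMul h x) - bump h‖ₑ ^ q := by
    intro h
    by_cases hh : h ∈ K
    · rw [Set.indicator_of_mem hh, enorm_rpow_eq_ofReal hq.le]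
      have hn : ‖h‖ ≤ 1 / 2 := mem_closedBall_zero_iff.1 hh
      refine ENNReal.ofReal_le_ofReal (Real.rpow_le_rpow (by norm_num) ?_ hq.le)
      have h1 : 1 ≤ ‖heisMul h x‖ := by
        by_contra hc
        have hc := (not_le.1 hc).le
        have b1 : |h.1| ≤ 1 / 2 := (norm_fst_le h).trans hn
        have b2 : |h.2.1| ≤ 1 / 2 := ((norm_fst_le h.2).trans (norm_snd_le h)).trans hn
        have b3 : |h.2.2| ≤ 1 / 2 := ((norm_snd_le h.2).trans (norm_snd_le h)).trans hn
        have c1 : |h.1 + x.1| ≤ 1 := (norm_fst_le (heisMul h x)).trans hc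
        have c2 : |h.2.1 + x.2.1| ≤ 1 :=
          ((norm_fst_le (heisMul h x).2).trans (norm_snd_le _)).trans hc
        have c3 : |h.2.2 + x.2.2 + h.1 * x.2.1| ≤ 1 :=
          ((norm_snd_le (heisMul h x).2).trans (norm_snd_le _)).trans hc
        refine not_le.2 hx ((heisGauge_le_iff (by norm_num)).2 ?_)
        have d1 : |x.1| ≤ 2 := by
          rw [abs_le] at *; constructor <;> linarith [b1.1, b1.2, c1.1, c1.2]
        have d2 : |x.2.1| ≤ 2 := by
          rw [abs_le] at *; constructor <;> linarith [b2.1, b2.2, c2.1, c2.2]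
        refine ⟨d1, d2, ?_⟩
        have d3 : |h.1 * x.2.1| ≤ 1 := by
          rw [abs_mul]
          calc |h.1| * |x.2.1| ≤ 1 / 2 * 2 := by gcongr
            _ = 1 := by norm_num
        rw [abs_le] at *
        constructor <;> linarith [b3.1, b3.2, c3.1, c3.2, d3.1, d3.2]
      rw [bump_eq_zero h1, zero_sub, abs_neg, abs_of_nonneg (bump_nonneg h)]
      exact le_max_of_le_right (by linarith)
    · rw [Set.indicator_of_notMem hh]
      exact zero_le
  have h := lintegral_mono (μ := volume) hle
  rw [lintegral_indicator_const measurableSet_closedBall,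
    volume_closedBall_zero _ (by norm_num)] at h
  simpa [bumpDiff] using h

/-! ### The energy: superposition over all scales. -/

/-- The measure `t ^ (s - 1) dt` on `(0, ∞)`. -/
noncomputable def scaleMeasure (s : ℝ) : Measure ℝ :=
  (volume.restrict (Set.Ioi 0)).withDensity fun t => ENNReal.ofReal (t ^ (s - 1))

instance (s : ℝ) : SigmaFinite (scaleMeasure s) := by
  unfold scaleMeasure
  infer_instance

theorem lintegral_scaleMeasure (s : ℝ) {f : ℝ → ℝ≥0∞} (hf : Measurable f) :
    ∫⁻ t, f t ∂scaleMeasure s = ∫⁻ t in Set.Ioi 0, ENNReal.ofReal (t ^ (s - 1)) * f t :=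
  lintegral_withDensity_eq_lintegral_mul _ (by fun_prop) hf

/-- The `q`-th power of a homogeneous gauge of degree `s / q` on the Heisenberg group: the
superposition of `bumpDiff q` over all scales. -/
noncomputable def energy (s q : ℝ) (x : ℝ × ℝ × ℝ) : ℝ≥0∞ :=
  ∫⁻ t, bumpDiff q (heisDil t⁻¹ x) ∂scaleMeasure s

theorem measurable_bumpDiff_heisDil (q : ℝ) (x : ℝ × ℝ × ℝ) :
    Measurable fun t : ℝ => bumpDiff q (heisDil t⁻¹ x) := by
  have h : Measurable fun t : ℝ => heisDil t⁻¹ x := by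
    unfold heisDil
    fun_prop
  exact (measurable_bumpDiff q).comp h

theorem measurable_energy (s q : ℝ) : Measurable (energy s q) := by
  have h : Measurable fun z : (ℝ × ℝ × ℝ) × ℝ => heisDil z.2⁻¹ z.1 := by
    unfold heisDil
    fun_prop
  exact ((measurable_bumpDiff q).comp h).lintegral_prod_right'

theorem energy_eq (s q : ℝ) (x : ℝ × ℝ × ℝ) : energy s q x =
    ∫⁻ t in Set.Ioi 0, ENNReal.ofReal (t ^ (s - 1)) * bumpDiff q (heisDil t⁻¹ x) :=
  lintegral_scaleMeasure s (measurable_bumpDiff_heisDil q x)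

theorem energy_heisInv (s q : ℝ) (x : ℝ × ℝ × ℝ) : energy s q (heisInv x) = energy s q x := by
  simp only [energy, heisDil_heisInv, bumpDiff_heisInv]

theorem energy_zero (s : ℝ) {q : ℝ} (hq : 0 < q) : energy s q 0 = 0 := by
  have h : ∀ t, heisDil t 0 = 0 := fun t => by simp [heisDil]
  simp [energy, h, bumpDiff_zero hq]

/-- The substitution t ↦ rt contributes r^(s-1) from the weight and r from the Jacobian. -/
theorem energy_heisDil (s q : ℝ) {r : ℝ} (hr : 0 < r) (x : ℝ × ℝ × ℝ) :
    energy s q (heisDil r x) = ENNReal.ofReal (r ^ s) * energy s q x := by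
  have hm : ∀ y, Measurable fun t : ℝ =>
      ENNReal.ofReal (t ^ (s - 1)) * bumpDiff q (heisDil t⁻¹ y) := fun y =>
    (by fun_prop : Measurable fun t : ℝ => ENNReal.ofReal (t ^ (s - 1))).mul
      (measurable_bumpDiff_heisDil q y)
  have hmr := ((hm (heisDil r x)).indicator (measurableSet_Ioi (a := 0))).comp
    (measurable_const_mul r)
  rw [Function.comp_def] at hmr
  rw [energy_eq, energy_eq, ← lintegral_indicator measurableSet_Ioi,
    ← lintegral_indicator measurableSet_Ioi,
    lintegral_comp_mul_left_of_pos ((hm _).indicator measurableSet_Ioi) hr,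
    ← lintegral_const_mul _ hmr, ← lintegral_const_mul _ ((hm _).indicator measurableSet_Ioi)]
  · refine lintegral_congr fun t => ?_
    by_cases ht : 0 < t
    · rw [Set.indicator_of_mem (show r * t ∈ Set.Ioi 0 from mul_pos hr ht),
        Set.indicator_of_mem (show t ∈ Set.Ioi 0 from ht), heisDil_heisDil, mul_inv,
        mul_right_comm r⁻¹, inv_mul_cancel₀ hr.ne', one_mul, Real.mul_rpow hr.le ht.le,
        ENNReal.ofReal_mul (Real.rpow_nonneg hr.le _), ← mul_assoc, ← mul_assoc, ← mul_assoc,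
        ← ENNReal.ofReal_mul hr.le, Real.rpow_sub_one hr.ne', mul_div_cancel₀ _ hr.ne']
    · rw [Set.indicator_of_notMem (show r * t ∉ Set.Ioi 0 from fun h =>
        ht (pos_of_mul_pos_right h hr.le)), Set.indicator_of_notMem (show t ∉ Set.Ioi 0 from ht),
        mul_zero, mul_zero]

theorem lintegral_Ioc_rpow {s r : ℝ} (hs : 0 < s) (hr : 0 < r) :
    ∫⁻ t in Set.Ioc 0 r, ENNReal.ofReal (t ^ (s - 1)) = ENNReal.ofReal (r ^ s / s) := by
  have hi : IntervalIntegrable (fun t : ℝ => t ^ (s - 1)) volume 0 r :=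
    intervalIntegral.intervalIntegrable_rpow' (by linarith)
  rw [← ofReal_integral_eq_lintegral_ofReal
    ((intervalIntegrable_iff_integrableOn_Ioc_of_le hr.le).1 hi)
    ((ae_restrict_iff' measurableSet_Ioc).2 (Filter.Eventually.of_forall fun t ht =>
      Real.rpow_nonneg ht.1.le _)),
    ← intervalIntegral.integral_of_le hr.le, integral_rpow (Or.inl (by linarith)),
    sub_add_cancel, Real.zero_rpow hs.ne', sub_zero]

theorem lintegral_Ioi_rpow {s : ℝ} (hs : s < 0) :
    ∫⁻ t in Set.Ioi (1 : ℝ), ENNReal.ofReal (t ^ (s - 1)) = ENNReal.ofReal (1 / -s) := by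
  rw [← ofReal_integral_eq_lintegral_ofReal
    (integrableOn_Ioi_rpow_of_lt (by linarith) one_pos)
    ((ae_restrict_iff' measurableSet_Ioi).2 (Filter.Eventually.of_forall fun t ht =>
      Real.rpow_nonneg (zero_le_one.trans (le_of_lt ht)) _)),
    integral_Ioi_rpow_of_lt (by linarith) one_pos, sub_add_cancel, Real.one_rpow, neg_div,
    one_div, one_div, inv_neg]

theorem energy_le_of_gauge_eq_one {s q : ℝ} (hs : 0 < s) (hq : 0 < q) (hsq : s < q)
    {x : ℝ × ℝ × ℝ} (hx : heisGauge x = 1) :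
    energy s q x ≤ ENNReal.ofReal (16 * (1 / s + 3 ^ q / (q - s))) := by
  -- Below scale 1 the trivial bound on `bumpDiff` suffices, since s > 0. Above it the Lipschitz
  -- bound gives decay t^(-q), integrable since s < q; this is the source of 1/(q - s).
  rw [energy_eq, ← Set.Ioc_union_Ioi_eq_Ioi zero_le_one]
  refine (lintegral_union_le _ _ _).trans ?_
  rw [mul_add, ENNReal.ofReal_add (by positivity)
    (mul_nonneg (by norm_num) (div_nonneg (by positivity) (by linarith)))]
  refine add_le_add ?_ ?_
  · calc _ ≤ ∫⁻ t in Set.Ioc 0 1, ENNReal.ofReal (t ^ (s - 1)) * 16 :=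
          lintegral_mono fun t => by gcongr; exact bumpDiff_le hq _
      _ = _ := by
          rw [lintegral_mul_const _ (by fun_prop), lintegral_Ioc_rpow hs one_pos, Real.one_rpow,
            mul_comm, ENNReal.ofReal_mul (by norm_num)]
          norm_num
  · calc _ ≤ ∫⁻ t in Set.Ioi 1,
            ENNReal.ofReal (16 * 3 ^ q) * ENNReal.ofReal (t ^ (s - q - 1)) := by
          refine setLIntegral_mono (by fun_prop) fun t ht => ?_
          have ht0 : 0 < t := zero_lt_one.trans ht
          calc _ ≤ ENNReal.ofReal (t ^ (s - 1)) *
                (16 * ENNReal.ofReal ((3 * heisGauge (heisDil t⁻¹ x)) ^ q)) := by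
                gcongr; exact bumpDiff_le_gauge hq _
            _ = _ := by
                rw [heisGauge_heisDil (inv_pos.2 ht0).le, hx, mul_one,
                  Real.mul_rpow (by norm_num) (inv_pos.2 ht0).le, Real.inv_rpow ht0.le,
                  show s - q - 1 = s - 1 - q by ring, Real.rpow_sub ht0 (s - 1) q,
                  show (16 : ℝ≥0∞) = ENNReal.ofReal 16 by norm_num,
                  ← ENNReal.ofReal_mul (by norm_num), ← ENNReal.ofReal_mul (by positivity),
                  ← ENNReal.ofReal_mul (by positivity)]
                congr 1
                ring
      _ = _ := by
          rw [lintegral_const_mul _ (by fun_prop), lintegral_Ioi_rpow (by linarith),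
            ← ENNReal.ofReal_mul (by positivity)]
          congr 1
          rw [neg_sub]
          ring

/-- At scales t ≤ 1/4 the rescaled point has gauge at least 4, so `le_bumpDiff` applies. -/
theorem le_energy_of_gauge_eq_one {s q : ℝ} (hs : 0 < s) (hq : 0 < q)
    {x : ℝ × ℝ × ℝ} (hx : heisGauge x = 1) :
    ENNReal.ofReal ((1 / 2) ^ q * ((1 / 4) ^ s / s)) ≤ energy s q x := by
  rw [energy_eq]
  calc _ = ∫⁻ t in Set.Ioc 0 (1 / 4),
        ENNReal.ofReal ((1 / 2) ^ q) * ENNReal.ofReal (t ^ (s - 1)) := by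
        rw [lintegral_const_mul _ (by fun_prop), lintegral_Ioc_rpow hs (by norm_num),
          ← ENNReal.ofReal_mul (by positivity)]
    _ ≤ ∫⁻ t in Set.Ioc 0 (1 / 4),
        ENNReal.ofReal (t ^ (s - 1)) * bumpDiff q (heisDil t⁻¹ x) := by
        refine setLIntegral_mono' measurableSet_Ioc fun t ht => ?_
        rw [mul_comm]
        gcongr
        refine le_bumpDiff hq ?_
        rw [heisGauge_heisDil (inv_pos.2 ht.1).le, hx, mul_one, lt_inv_comm₀ two_pos ht.1]
        exact ht.2.trans_lt (by norm_num)
    _ ≤ _ := lintegral_mono_set fun t ht => ht.1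

theorem exists_heisDil_eq {x : ℝ × ℝ × ℝ} (hx : x ≠ 0) :
    ∃ y, heisGauge y = 1 ∧ x = heisDil (heisGauge x) y := by
  have h := heisGauge_pos hx
  refine ⟨heisDil (heisGauge x)⁻¹ x, ?_, ?_⟩
  · rw [heisGauge_heisDil (inv_pos.2 h).le, inv_mul_cancel₀ h.ne']
  · rw [heisDil_heisDil, mul_inv_cancel₀ h.ne']
    simp [heisDil]

theorem heisGauge_zero : heisGauge 0 = 0 := by simp [heisGauge]

theorem energy_le {s q : ℝ} (hs : 0 < s) (hq : 0 < q) (hsq : s < q) (x : ℝ × ℝ × ℝ) :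
    energy s q x ≤ ENNReal.ofReal (heisGauge x ^ s * (16 * (1 / s + 3 ^ q / (q - s)))) := by
  rcases eq_or_ne x 0 with rfl | hx
  · simp [energy_zero s hq]
  · obtain ⟨y, hy, hxy⟩ := exists_heisDil_eq hx
    have hg := heisGauge_pos hx
    conv_lhs => rw [hxy]
    rw [energy_heisDil s q hg, ENNReal.ofReal_mul (by positivity)]
    gcongr
    exact energy_le_of_gauge_eq_one hs hq hsq hy

theorem le_energy {s q : ℝ} (hs : 0 < s) (hq : 0 < q) (x : ℝ × ℝ × ℝ) :
    ENNReal.ofReal (heisGauge x ^ s * ((1 / 2) ^ q * ((1 / 4) ^ s / s))) ≤ energy s q x := by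
  rcases eq_or_ne x 0 with rfl | hx
  · simp [heisGauge_zero, Real.zero_rpow hs.ne']
  · obtain ⟨y, hy, hxy⟩ := exists_heisDil_eq hx
    have hg := heisGauge_pos hx
    conv_rhs => rw [hxy]
    rw [energy_heisDil s q hg, ENNReal.ofReal_mul (by positivity)]
    gcongr
    exact le_energy_of_gauge_eq_one hs hq hy

theorem energy_ne_top {s q : ℝ} (hs : 0 < s) (hq : 0 < q) (hsq : s < q) (x : ℝ × ℝ × ℝ) :
    energy s q x ≠ ∞ :=
  ((energy_le hs hq hsq x).trans_lt ENNReal.ofReal_lt_top).ne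

/-! ### Profiles realise the energy as an `L_q` distance. -/

/-- The profile of a point of the Heisenberg group: its translates of `bump` at all scales. -/
noncomputable def profile (x : ℝ × ℝ × ℝ) (w : ℝ × (ℝ × ℝ × ℝ)) : ℝ :=
  bump (heisMul w.2 (heisDil w.1⁻¹ x))

theorem measurable_profile (x : ℝ × ℝ × ℝ) : Measurable (profile x) :=
  continuous_bump.measurable.comp (continuous_heisMul.measurable.comp
    (measurable_snd.prodMk (continuous_heisDil.measurable.comp
      (measurable_fst.inv.prodMk measurable_const))))

theorem lintegral_profile_sub (s q : ℝ) (x y : ℝ × ℝ × ℝ) :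
    ∫⁻ w, ‖profile x w - profile y w‖ₑ ^ q ∂((scaleMeasure s).prod volume) =
      energy s q (heisMul (heisInv y) x) := by
  have hm : Measurable fun w => ‖profile x w - profile y w‖ₑ ^ q :=
    ((measurable_profile x).sub (measurable_profile y)).enorm.pow_const q
  rw [lintegral_prod _ hm.aemeasurable, energy]
  refine lintegral_congr fun t => ?_
  simp only [profile]
  rw [lintegral_bump_sub, heisDil_heisMul, heisDil_heisInv]

theorem energy_heisMul_rpow_le (s : ℝ) {q : ℝ} (hq : 1 ≤ q) (x y : ℝ × ℝ × ℝ) :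
    energy s q (heisMul x y) ^ (1 / q) ≤ energy s q x ^ (1 / q) + energy s q y ^ (1 / q) := by
  have h1 := lintegral_profile_sub s q (heisMul x y) 0
  have h2 := lintegral_profile_sub s q x 0
  have h3 := lintegral_profile_sub s q (heisMul x y) x
  have h0 : heisInv 0 = 0 := by simp [heisInv]
  rw [h0, zero_heisMul] at h1 h2
  rw [← heisMul_assoc, heisInv_heisMul, zero_heisMul] at h3
  rw [← h1, ← h2, ← h3, add_comm]
  have hm : ∀ x y, Measurable fun w => ‖profile x w - profile y w‖ₑ := fun x y =>
    ((measurable_profile x).sub (measurable_profile y)).enorm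
  refine le_trans ?_ (ENNReal.lintegral_Lp_add_le (hm (heisMul x y) x).aemeasurable
    (hm x 0).aemeasurable hq)
  gcongr with w
  rw [Pi.add_apply]
  calc ‖profile (heisMul x y) w - profile 0 w‖ₑ = ‖(profile (heisMul x y) w - profile x w) +
        (profile x w - profile 0 w)‖ₑ := by rw [sub_add_sub_cancel]
    _ ≤ _ := enorm_add_le _ _

/-! ### From separated sets to doubling. -/

/-- A separated subset of the ball of maximal cardinality is a net: a point it failed to cover could
be added. Its points serve as centres, so they lie in the space itself. -/
theorem isKDoubling_of_separated {X : Type*} [PseudoMetricSpace X] {K : ℝ}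
    (h : ∀ (x : X) (r : ℝ), 0 < r → ∀ s : Finset X, (∀ y ∈ s, dist y x ≤ r) →
      (∀ y ∈ s, ∀ y' ∈ s, y ≠ y' → r / 2 < dist y y') → (s.card : ℝ) ≤ K) :
    IsKDoubling K X := by
  classical
  intro x r hr
  set P : ℕ → Prop := fun n => ∃ s : Finset X, s.card = n ∧ (∀ y ∈ s, dist y x ≤ r) ∧
    (∀ y ∈ s, ∀ y' ∈ s, y ≠ y' → r / 2 < dist y y') with hP
  have hP0 : P 0 := ⟨∅, by simp⟩
  obtain ⟨s, hcard, hball, hsep⟩ : P (Nat.findGreatest P ⌊K⌋₊) :=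
    Nat.findGreatest_spec (Nat.zero_le _) hP0
  refine ⟨s, h x r hr s hball hsep, fun z hz => ?_⟩
  by_contra hc
  simp only [Set.mem_iUnion, Metric.mem_closedBall, not_exists, not_le] at hc
  have hzs : z ∉ s := fun hzs => by
    have := hc z hzs
    rw [dist_self] at this
    linarith
  have hball' : ∀ y ∈ insert z s, dist y x ≤ r := by
    intro y hy
    rcases Finset.mem_insert.1 hy with rfl | hy
    · exact hz
    · exact hball y hy
  have hsep' : ∀ y ∈ insert z s, ∀ y' ∈ insert z s, y ≠ y' → r / 2 < dist y y' := by
    intro y hy y' hy' hne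
    rcases Finset.mem_insert.1 hy with h1 | h1 <;> rcases Finset.mem_insert.1 hy' with h2 | h2
    · exact absurd (h1.trans h2.symm) hne
    · rw [h1]; exact hc y' h2
    · rw [h2, dist_comm]; exact hc y h1
    · exact hsep y h1 y' h2 hne
  have h1 := Nat.le_floor (h x r hr _ hball' hsep')
  have h2 := Nat.le_findGreatest h1 (show P _ from ⟨_, rfl, hball', hsep'⟩)
  rw [Finset.card_insert_of_notMem hzs] at h2
  omega

/-! ### The embedding of the real group and its constants. -/

/-- The map into `L_p` on the real Heisenberg group whose `L_p` distances are given by `energy`: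
the snowflake of the profile. -/
theorem exists_energy_embedding {s p q : ℝ} (hq : 1 < q) (hqp : q < p) (hs : 0 < s)
    (hsq : s < q) [Fact (1 ≤ ENNReal.ofReal p)] :
    ∃ G : ℝ × ℝ × ℝ → LpUnit p, ∀ x y,
      ‖G x - G y‖ = (energy s q (heisMul (heisInv x) y)).toReal ^ (1 / p) := by
  have hq0 : 0 < q := by linarith
  have hp : 0 < p := by linarith
  have hβ : (q - 1) / p * p + 1 = q := by field_simp; ring
  -- With β = (q - 1)/p the snowflake exponent βp + 1 is q, and the integrability condition (β - 1)p
  -- < -1 is exactly q < p.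
  obtain ⟨g, hg, hgint⟩ := exists_snowflake (β := (q - 1) / p) (p := p)
    (div_pos (by linarith) hp) ((div_lt_one hp).2 (by linarith)) hp
    (by rw [sub_mul, div_mul_cancel₀ _ hp.ne']; linarith)
  rw [hβ] at hgint
  set μ := (scaleMeasure s).prod (volume : Measure (ℝ × ℝ × ℝ))
  obtain ⟨Φ, hΦ⟩ := exists_isometric_LpUnit (μ.prod (volume : Measure ℝ)) hp
  -- Only differences of translates of g are known to be p-integrable, so the image of the base
  -- point 0 is subtracted; this does not change distances.
  set Γ : ℝ × ℝ × ℝ → (ℝ × (ℝ × ℝ × ℝ)) × ℝ → ℝ := fun x z =>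
    g (z.2 + profile x z.1) - g (z.2 + profile 0 z.1) with hΓ
  have hm1 : ∀ x, Measurable fun z : (ℝ × (ℝ × ℝ × ℝ)) × ℝ => g (z.2 + profile x z.1) :=
    fun x => hg.comp (measurable_snd.add ((measurable_profile x).comp measurable_fst))
  have hΓm : ∀ x, Measurable (Γ x) := fun x => (hm1 x).sub (hm1 0)
  have hdist : ∀ x y, ∫⁻ z, ‖Γ x z - Γ y z‖ₑ ^ p ∂(μ.prod volume) =
      energy s q (heisMul (heisInv y) x) := by
    intro x y
    have hmm : Measurable fun z => ‖Γ x z - Γ y z‖ₑ ^ p :=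
      ((hΓm x).sub (hΓm y)).enorm.pow_const p
    rw [lintegral_prod _ hmm.aemeasurable, ← lintegral_profile_sub]
    refine lintegral_congr fun w => ?_
    simp only [hΓ, sub_sub_sub_cancel_right]
    exact hgint _ _
  have hΓ0 : ∀ z, Γ 0 z = 0 := fun z => sub_self _
  have hfin : ∀ x, ∫⁻ z, ‖Γ x z‖ₑ ^ p ∂(μ.prod volume) ≠ ∞ := by
    intro x
    have h := hdist x 0
    simp only [hΓ0, sub_zero] at h
    rw [h]
    exact energy_ne_top hs hq0 hsq _
  refine ⟨fun x => Φ (Γ x), fun x y => ?_⟩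
  have h := hΦ (Γ x) (Γ y) (hΓm x) (hΓm y) (hfin x) (hfin y)
  rw [hdist, ← energy_heisInv, heisInv_heisMul_rev, heisInv_heisInv] at h
  rw [← h, ← ENNReal.toReal_rpow, toReal_enorm, ← Real.rpow_mul (norm_nonneg _),
    mul_one_div_cancel hp.ne', Real.rpow_one]

/-- The factor 1/s is absorbed through s ≤ p ≤ 2^p, whence 16 = 2 · 4 · 2. -/
theorem lower_const {p q s : ℝ} (hp : 1 ≤ p) (hqp : q ≤ p) (hs : 0 < s) (hsp : s ≤ p) :
    (1 / 16 : ℝ) ^ p ≤ (1 / 2) ^ q * ((1 / 4) ^ s / s) := by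
  have h1 : p ≤ 2 ^ p := by
    have := one_add_mul_self_le_rpow_one_add (s := 1) (by norm_num) hp
    norm_num at this
    linarith
  have h2 : (1 / 2 : ℝ) ^ p ≤ 1 / s := by
    rw [one_div, Real.inv_rpow (by norm_num), ← one_div]
    exact one_div_le_one_div_of_le hs (by linarith)
  have h3 : (1 / 2 : ℝ) ^ p ≤ (1 / 2) ^ q :=
    Real.rpow_le_rpow_of_exponent_ge (by norm_num) (by norm_num) hqp
  have h4 : (1 / 4 : ℝ) ^ p ≤ (1 / 4) ^ s :=
    Real.rpow_le_rpow_of_exponent_ge (by norm_num) (by norm_num) hsp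
  calc (1 / 16 : ℝ) ^ p = (1 / 2) ^ p * ((1 / 4) ^ p * (1 / 2) ^ p) := by
        rw [← Real.mul_rpow (by norm_num) (by norm_num),
          ← Real.mul_rpow (by norm_num) (by norm_num)]
        norm_num
    _ ≤ (1 / 2) ^ q * ((1 / 4) ^ s * (1 / s)) := by gcongr
    _ = _ := by rw [mul_one_div]

/-- The bracket is at most 3 · 3^p/ε, since 1/s ≤ 3^p/ε and 1/(q - s) ≤ 2/ε. Then 16 · 3 = 48 ≤
48^p, so that the p-th root costs only 48 · 3 = 144. -/
theorem upper_const {p q s ε : ℝ} (hε : 0 < ε) (hε1 : ε ≤ 1 / 2) (hp : 1 ≤ p) (hqp : q ≤ p)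
    (hs : 1 ≤ s) (hqs : ε / 2 ≤ q - s) :
    16 * (1 / s + 3 ^ q / (q - s)) ≤ 144 ^ p / ε := by
  have h1 : 1 / s ≤ 1 := by rw [div_le_one (by linarith)]; exact hs
  have h2 : (3 : ℝ) ^ q ≤ 3 ^ p := Real.rpow_le_rpow_of_exponent_le (by norm_num) hqp
  have h3 : (3 : ℝ) ^ q / (q - s) ≤ 3 ^ p / (ε / 2) := by gcongr
  have h4 : (1 : ℝ) ≤ 3 ^ p := Real.one_le_rpow (by norm_num) (by linarith)
  have h5 : 1 ≤ 3 ^ p / ε := by rw [le_div_iff₀ hε]; linarith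
  have h6 : (48 : ℝ) ≤ 48 ^ p := by
    simpa using Real.rpow_le_rpow_of_exponent_le (by norm_num : (1 : ℝ) ≤ 48) hp
  have h7 : (3 : ℝ) ^ p / (ε / 2) = 2 * (3 ^ p / ε) := by field_simp
  calc 16 * (1 / s + 3 ^ q / (q - s)) ≤ 48 * (3 ^ p / ε) := by linarith
    _ ≤ 48 ^ p * (3 ^ p / ε) := by gcongr
    _ = 144 ^ p / ε := by
        rw [← mul_div_assoc, ← Real.mul_rpow (by norm_num) (by norm_num)]
        norm_num

/-- The bound for the cardinality of separated sets, for the metric given by a power of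
`energy`. -/
theorem card_le_of_energy_separated {s p q : ℝ} (hp : 0 < p) (hq : 1 ≤ q) (hs : 0 < s)
    (hsq : s < q) (hpq : p / q ≤ 3 / 2) (hκ : 3 / 4 ≤ s / q)
    {S : Finset (ℝ × ℝ × ℝ)} {r : ℝ} (hr : 0 < r) {x₀ : ℝ × ℝ × ℝ}
    (hS : ∀ y ∈ S, (energy s q (heisMul (heisInv x₀) y)).toReal ^ (1 / p) ≤ r)
    (hsep : ∀ y ∈ S, ∀ y' ∈ S, y ≠ y' →
      r / 2 ≤ (energy s q (heisMul (heisInv y) y')).toReal ^ (1 / p)) :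
    (S.card : ℝ) ≤ 2 ^ 16 := by
  have hq0 : 0 < q := by linarith
  have hκ0 : 0 < s / q := div_pos hs hq0
  set M : ℝ × ℝ × ℝ → ℝ := fun x => (energy s q x).toReal ^ (1 / q) with hM
  have hfin := energy_ne_top hs hq0 hsq
  -- M, not `energy`^(1/p), is used for packing: it has the larger degree s/q, at the price of
  -- raising radii to the power p/q.
  have hpow : ∀ x, M x = ((energy s q x).toReal ^ (1 / p)) ^ (p / q) := by
    intro x
    rw [hM, ← Real.rpow_mul ENNReal.toReal_nonneg]
    field_simp
  have hg : ∀ (x : ℝ × ℝ × ℝ) {c : ℝ}, 0 ≤ c →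
      (heisGauge x ^ s * c) ^ (1 / q) = c ^ (1 / q) * heisGauge x ^ (s / q) := by
    intro x c hc
    rw [Real.mul_rpow (Real.rpow_nonneg (heisGauge_nonneg x) _) hc,
      ← Real.rpow_mul (heisGauge_nonneg x), mul_one_div, mul_comm]
  have hc2 : 0 ≤ 16 * (1 / s + 3 ^ q / (q - s)) := by
    have : 0 < q - s := by linarith
    positivity
  have key := card_le_of_separated (M := M) (κ := s / q)
    (c₁ := ((1 / 2) ^ q * ((1 / 4) ^ s / s)) ^ (1 / q))
    (c₂ := (16 * (1 / s + 3 ^ q / (q - s))) ^ (1 / q)) (s := S) (R := r ^ (p / q))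
    (t := (r / 2) ^ (p / q)) (x₀ := x₀) hκ0
    ((measurable_energy s q).ennreal_toReal.pow_const _) ?_ ?_ ?_ (by positivity) ?_ ?_
    (by positivity) (by positivity) ?_ ?_
  · refine key.trans ?_
    have e : 2 * r ^ (p / q) / (r / 2) ^ (p / q) = 2 * 2 ^ (p / q) := by
      rw [mul_div_assoc, ← Real.div_rpow hr.le (by positivity)]
      congr 2
      field_simp
    rw [e]
    have h1 : (2 : ℝ) ^ (p / q) ≤ 7 / 2 := by
      calc (2 : ℝ) ^ (p / q) ≤ 2 ^ (3 / 2 : ℝ) :=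
            Real.rpow_le_rpow_of_exponent_le (by norm_num) hpq
        _ ≤ 7 / 2 := by
            refine (Real.rpow_le_rpow_iff (by positivity) (by norm_num) two_pos).1 ?_
            rw [← Real.rpow_mul (by norm_num)]
            norm_num
    have h2 : 4 / (s / q) ≤ 16 / 3 := by
      rw [div_le_iff₀ hκ0]
      linarith
    calc (1 + 2 * (2 : ℝ) ^ (p / q)) ^ (4 / (s / q)) ≤ 8 ^ (4 / (s / q)) :=
          Real.rpow_le_rpow (by positivity) (by linarith) (by positivity)
      _ ≤ 8 ^ (16 / 3 : ℝ) := Real.rpow_le_rpow_of_exponent_le (by norm_num) h2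
      _ = 2 ^ 16 := by
          rw [show (8 : ℝ) = 2 ^ (3 : ℝ) by norm_num, ← Real.rpow_mul (by norm_num)]
          norm_num
  · intro t ht x
    simp only [hM]
    rw [energy_heisDil s q ht, ENNReal.toReal_mul,
      ENNReal.toReal_ofReal (Real.rpow_nonneg ht.le _),
      Real.mul_rpow (Real.rpow_nonneg ht.le _) ENNReal.toReal_nonneg, ← Real.rpow_mul ht.le,
      mul_one_div]
  · intro x
    simp only [hM, energy_heisInv]
  · intro x y
    simp only [hM, ENNReal.toReal_rpow]
    have hr : ∀ x, energy s q x ^ (1 / q) ≠ ∞ := fun x =>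
      ENNReal.rpow_ne_top_of_nonneg (by positivity) (hfin x)
    rw [← ENNReal.toReal_add (hr x) (hr y)]
    exact ENNReal.toReal_mono (ENNReal.add_ne_top.2 ⟨hr x, hr y⟩)
      (energy_heisMul_rpow_le s hq x y)
  · intro x
    have hx := heisGauge_nonneg x
    rw [← hg x (by positivity)]
    exact Real.rpow_le_rpow (by positivity)
      ((ENNReal.ofReal_le_iff_le_toReal (hfin x)).1 (le_energy hs hq0 x)) (by positivity)
  · intro x
    have hx := heisGauge_nonneg x
    rw [← hg x hc2]
    exact Real.rpow_le_rpow ENNReal.toReal_nonneg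
      (ENNReal.toReal_le_of_le_ofReal (by positivity) (energy_le hs hq0 hsq x)) (by positivity)
  · intro y hy
    rw [hpow]
    exact Real.rpow_le_rpow (by positivity) (hS y hy) (by positivity)
  · intro y hy y' hy' hne
    rw [hpow]
    exact Real.rpow_le_rpow (by positivity) (hsep y hy y' hy' hne) (by positivity)

/-! ### Assembly. -/

theorem theorem1p4 :
    ∃ C : ℝ, 0 < C ∧
      ∀ ε : ℝ, 0 < ε → ε ≤ 1 / 2 →
      -- the `Fact` (needed for the norm of `L_p`) follows from `2 ≤ p`
      ∀ p : ℝ, 2 ≤ p → ∀ [Fact (1 ≤ ENNReal.ofReal p)],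
        ∃ F : DiscreteHeisenberg → LpUnit p,
          IsKDoubling (2 ^ 16) (Set.range F) ∧
          ∀ x y : DiscreteHeisenberg,
            (DiscreteHeisenberg.wordDist x y : ℝ) ^ (1 - ε) ≤ ‖F x - F y‖ ∧
            ‖F x - F y‖ ≤ C * ((DiscreteHeisenberg.wordDist x y : ℝ) ^ (1 - ε) / ε ^ (1 / p)) := by
  -- The map is scaled by 192 = 12 · 16, with 12 from `wordLength_le_heisGauge` and 16 from
  -- `lower_const`; 144 comes from `upper_const`.
  refine ⟨192 * 144, by norm_num, fun ε hε hε1 p hp _ => ?_⟩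
  have hp0 : 0 < p := by linarith
  set s : ℝ := (1 - ε) * p with hs
  -- This q makes s/q = 1 - ε/2 ≥ 3/4 and p/q = (1 - ε/2)/(1 - ε) ≤ 3/2, while q - s = qε/2 stays of
  -- order at least ε.
  set q : ℝ := s / (1 - ε / 2) with hq
  have hd : 0 < 1 - ε / 2 := by linarith
  have hs1 : 1 ≤ s := by nlinarith
  have hs0 : 0 < s := by linarith
  have hsq' : s = q * (1 - ε / 2) := (div_mul_cancel₀ s hd.ne').symm
  have hq1 : 4 / 3 ≤ q := by
    rw [hq, le_div_iff₀ hd, hs]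
    nlinarith
  have hq0 : 0 < q := by linarith
  have hqp : q < p := by
    rw [hq, div_lt_iff₀ hd, hs]
    nlinarith
  have hqs : ε / 2 ≤ q - s := by nlinarith
  have hsq : s < q := by linarith
  obtain ⟨G, hG⟩ := exists_energy_embedding (s := s) (p := p) (q := q) (by linarith) hqp hs0 hsq
  have hlow : ∀ x, heisGauge x ^ (1 - ε) / 16 ≤ (energy s q x).toReal ^ (1 / p) := by
    intro x
    have hx := heisGauge_nonneg x
    have h1 := (ENNReal.ofReal_le_iff_le_toReal (energy_ne_top hs0 hq0 hsq x)).1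
      (le_energy hs0 hq0 x)
    rw [one_div p, Real.le_rpow_inv_iff_of_pos (by positivity) ENNReal.toReal_nonneg hp0]
    refine le_trans ?_ h1
    rw [div_eq_mul_one_div, Real.mul_rpow (by positivity) (by norm_num), ← Real.rpow_mul hx]
    gcongr
    exact lower_const (by linarith) hqp.le hs0 (by linarith)
  have hupp : ∀ x, (energy s q x).toReal ^ (1 / p) ≤
      144 * (heisGauge x ^ (1 - ε) / ε ^ (1 / p)) := by
    intro x
    have hx := heisGauge_nonneg x
    have hc := upper_const hε hε1 (by linarith : 1 ≤ p) hqp.le hs1 hqs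
    have h1 : (energy s q x).toReal ≤ heisGauge x ^ s * (144 ^ p / ε) :=
      ENNReal.toReal_le_of_le_ofReal (by positivity) ((energy_le hs0 hq0 hsq x).trans
        (ENNReal.ofReal_le_ofReal (by gcongr)))
    refine (Real.rpow_le_rpow ENNReal.toReal_nonneg h1 (by positivity)).trans (le_of_eq ?_)
    rw [Real.mul_rpow (by positivity) (by positivity), Real.div_rpow (by positivity) hε.le,
      ← Real.rpow_mul hx, ← Real.rpow_mul (by norm_num), mul_one_div_cancel hp0.ne', Real.rpow_one,
      mul_one_div, hs, mul_div_cancel_right₀ _ hp0.ne']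
    ring
  have hnorm : ∀ x y, ‖(192 : ℝ) • G x - (192 : ℝ) • G y‖ =
      192 * (energy s q (heisMul (heisInv x) y)).toReal ^ (1 / p) := by
    intro x y
    rw [← smul_sub, norm_smul, hG]
    norm_num
  refine ⟨fun x => (192 : ℝ) • G x.coords, ?_, fun x y => ?_⟩
  · refine isKDoubling_of_separated fun X r hr S hS hsep => ?_
    -- Packing is carried out in the real group, on arbitrary preimages v of the image points;
    -- separation passes to any subset of the group.
    have hrep : ∀ Y : Set.range fun x : DiscreteHeisenberg => (192 : ℝ) • G x.coords,
        ∃ v, (192 : ℝ) • G v = Y := fun Y => Y.2.imp' _ fun _ h => h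
    choose v hv using hrep
    have hdist : ∀ Y Z, dist Y Z =
        192 * (energy s q (heisMul (heisInv (v Y)) (v Z))).toReal ^ (1 / p) := by
      intro Y Z
      rw [← hnorm, hv, hv, Subtype.dist_eq, dist_eq_norm]
    have hinj : Function.Injective v := fun Y Z h => Subtype.ext (by rw [← hv, ← hv, h])
    rw [← Finset.card_map ⟨v, hinj⟩]
    refine card_le_of_energy_separated (s := s) (p := p) (q := q) (r := r / 192) (x₀ := v X) hp0
      (by linarith) hs0 hsq ?_ ?_ (by positivity) ?_ ?_
    · rw [div_le_iff₀ hq0, hq, hs, ← mul_div_assoc, le_div_iff₀ hd]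
      nlinarith
    · rw [le_div_iff₀ hq0]
      nlinarith
    · intro y hy
      obtain ⟨Y, hY, rfl⟩ := Finset.mem_map.1 hy
      have h := hS Y hY
      rw [dist_comm, hdist] at h
      rw [le_div_iff₀' (by norm_num)]
      exact h
    · intro y hy y' hy' hne
      obtain ⟨Y, hY, rfl⟩ := Finset.mem_map.1 hy
      obtain ⟨Z, hZ, rfl⟩ := Finset.mem_map.1 hy'
      have h := hsep Y hY Z hZ fun h => hne (by rw [h])
      rw [hdist] at h
      rw [div_right_comm, div_le_iff₀' (by norm_num)]
      exact h.le
  · rw [hnorm, ← DiscreteHeisenberg.coords_inv, ← DiscreteHeisenberg.coords_mul,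
      DiscreteHeisenberg.wordDist]
    set w := x⁻¹ * y
    have hg := heisGauge_nonneg w.coords
    have hθ : 0 ≤ 1 - ε := by linarith
    constructor
    · have h12 : (12 : ℝ) ^ (1 - ε) ≤ 12 := by
        simpa using Real.rpow_le_rpow_of_exponent_le (by norm_num : (1 : ℝ) ≤ 12)
          (by linarith : 1 - ε ≤ 1)
      calc (w.wordLength : ℝ) ^ (1 - ε) ≤ (12 * heisGauge w.coords) ^ (1 - ε) :=
            Real.rpow_le_rpow (Nat.cast_nonneg _) w.wordLength_le_heisGauge hθ
        _ ≤ 12 * heisGauge w.coords ^ (1 - ε) := by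
            rw [Real.mul_rpow (by norm_num) hg]
            gcongr
        _ ≤ _ := by linarith [hlow w.coords]
    · have h1 := hupp w.coords
      have h2 : heisGauge w.coords ^ (1 - ε) / ε ^ (1 / p) ≤
          (w.wordLength : ℝ) ^ (1 - ε) / ε ^ (1 / p) := by
        gcongr
        exact w.heisGauge_coords_le
      linarith
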